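/- For $\alpha\ge 0$ and $\Omega\subset\mathbb R$, let $C^\alpha(\Omega)$ denote the space of functions on $\Omega$ that are continuously differentiable with bounded derivatives up to order $\lfloor\alpha\rfloor$ (continuous and bounded if $\lfloor\alpha\rfloor=0$) and whose derivative of order $\lfloor\alpha\rfloor$ satisfies the Hölder condition with index $\alpha-\lfloor\alpha\rfloor$ on $\Omega$. For $0<s<1$ let $$(-\Delta)^su(x):=c_s\,\mathrm{P.V.}\!\int_{\mathbb R}\frac{u(x)-u(y)}{|x-y|^{1+2s}}\,dy,\qquad c_s:=\frac{s\,4^s\,\Gamma(\frac12+s)}{\sqrt\pi\,\Gamma(1-s)}.$$ **Proposition 3.1.** Let $0<\beta<1$ and $0<2s\le 1-\beta$. There exist two functions $u\in C^{\frac{2s}{1-\beta}}(\mathbb R)$ and $f\in C^\beta(\mathbb R)$ such that $u$ is periodic, $(-\Delta)^su(x)$ is well defined and equal to $f(u(x))$ for every $x\in\mathbb R$, and $$u\notin C^{\frac{2s}{1-\beta}+\epsilon}([-\rho,\rho])\qquad\text{for all }\epsilon>0\text{ and }\rho>0.$$ -/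

import Mathlib

open Set Filter Topology MeasureTheory

/-- The Hölder class `C^α(Ω)` for `α ≥ 0` and `Ω ⊆ ℝ`: functions that are continuously
differentiable on `Ω` with bounded derivatives up to order `⌊α⌋` and whose derivative of order
`⌊α⌋` satisfies the Hölder condition with index `α - ⌊α⌋` on `Ω`. (For `⌊α⌋ = 0` the first two
clauses say that `u` is continuous and bounded on `Ω`; derivatives at an end point of an interval
are one-sided.) -/
def HolderClass (α : ℝ) (Ω : Set ℝ) (u : ℝ → ℝ) : Prop :=
  ContDiffOn ℝ (⌊α⌋₊ : ℕ) u Ω ∧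
  (∀ k : ℕ, k ≤ ⌊α⌋₊ → ∃ M : ℝ, ∀ x ∈ Ω, |iteratedDerivWithin k u Ω x| ≤ M) ∧
  ∃ C : ℝ, ∀ x ∈ Ω, ∀ y ∈ Ω,
    |iteratedDerivWithin ⌊α⌋₊ u Ω x - iteratedDerivWithin ⌊α⌋₊ u Ω y|
      ≤ C * |x - y| ^ (α - (⌊α⌋₊ : ℝ))

/-- The normalizing constant `c_s = s 4^s Γ(1/2 + s) / (√π Γ(1 - s))`. -/
noncomputable def fracLaplacianConst (s : ℝ) : ℝ :=
  s * (4 : ℝ) ^ s * Real.Gamma (1 / 2 + s) / (Real.sqrt Real.pi * Real.Gamma (1 - s))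

/-- `HasFracLaplacianAt s u x v` says that `(-Δ)^s u (x)` is well defined and equal to `v`: the
integrand `(u(x) - u(y)) / |x - y|^(1+2s)` is integrable off every neighbourhood of `x`, and the
principal value, i.e. the limit as `δ ↓ 0` of the integrals over `|x - y| > δ`, exists and, once
multiplied by `c_s`, equals `v`. -/
def HasFracLaplacianAt (s : ℝ) (u : ℝ → ℝ) (x v : ℝ) : Prop :=
  (∀ δ : ℝ, 0 < δ →
    IntegrableOn (fun y : ℝ => (u x - u y) / |x - y| ^ (1 + 2 * s)) {y : ℝ | δ < |x - y|}) ∧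
  Tendsto
    (fun δ : ℝ => fracLaplacianConst s *
      ∫ y in {y : ℝ | δ < |x - y|}, (u x - u y) / |x - y| ^ (1 + 2 * s))
    (𝓝[>] 0) (𝓝 v)

/-!
For `α = 2s / (1 - β) ≤ 1` the function `logPower α t = |t|^α / (1 - log |t|)` is `C^α`, and no
better at its minimum `0`. Combining such minima and the opposite maxima periodically gives
`u = logPower α ∘ sin - logPower α ∘ cos`. At an interior minimum a `C^(α + ε)` function is flat of
order `min (α + ε) 2`, so the logarithm excludes every `ε > 0`.

A function `f` with `(-Δ)^s u = f ∘ u` can be chosen `C^β` as soon as `H = (-Δ)^s u` satisfies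
`|H x - H y| ≤ K |u x - u y|^β`. By the symmetries of `u` this is only needed on `[0, π / 4]`.
For `x < y ≤ 2x`, rescaling by `x` turns `u - u 0` into a function of size `φ = logPower α x` which
is Lipschitz near the two points, and `|u x - u y| ≥ c φ r` with `r = (y - x) / x`. Hence
`|H x - H y| ≤ K x^(-2s) φ r^(1 - 2s) ≤ K x^(-2s) φ^(1 - β) (φ r)^β ≤ K' |u x - u y|^β`,
because `β ≤ 1 - 2s` and `φ^(1 - β) ≤ x^(α (1 - β)) = x^(2s)`. Points at different scales are
compared through the minimum `0`, by summing over dyadic scales.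
-/

open Real

/-! ### The absolutely convergent fractional Laplacian -/

theorem integrable_min_rpow_one_div_rpow {p q : ℝ} (hq : 0 < q) (hp : q < p) :
    Integrable fun z : ℝ => min (|z| ^ p) 1 / |z| ^ (1 + q) := by
  have hmeas : AEStronglyMeasurable (fun z : ℝ => min (z ^ p) 1 / z ^ (1 + q)) := by
    apply Measurable.aestronglyMeasurable
    fun_prop
  have near : IntegrableOn (fun z : ℝ => min (z ^ p) 1 / z ^ (1 + q)) (Ioc 0 1) := by
    have hint : IntegrableOn (fun z : ℝ => z ^ (p - (1 + q))) (Ioc 0 1) :=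
      (intervalIntegrable_iff_integrableOn_Ioc_of_le zero_le_one).1
        (intervalIntegral.intervalIntegrable_rpow' (by linarith))
    refine hint.mono' hmeas.restrict (ae_restrict_of_forall_mem measurableSet_Ioc fun z hz => ?_)
    have hz0 : 0 < z := hz.1
    rw [norm_of_nonneg (by positivity), rpow_sub hz0]
    gcongr
    exact min_le_left _ _
  have far : IntegrableOn (fun z : ℝ => min (z ^ p) 1 / z ^ (1 + q)) (Ioi 1) := by
    refine (integrableOn_Ioi_rpow_of_lt (by linarith : -(1 + q) < -1) one_pos).mono'
      hmeas.restrict (ae_restrict_of_forall_mem measurableSet_Ioi fun z hz => ?_)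
    have hz0 : 0 < z := one_pos.trans hz
    rw [norm_of_nonneg (by positivity), rpow_neg hz0.le, ← one_div]
    gcongr
    exact min_le_right _ _
  have hpos := near.union far
  rw [Ioc_union_Ioi_eq_Ioi zero_le_one] at hpos
  refine (integrable_fun_norm_addHaar (volume : Measure ℝ)
    (f := fun z : ℝ => min (z ^ p) 1 / z ^ (1 + q))).2 ?_
  simpa only [Module.finrank_self, tsub_self, pow_zero, one_smul] using hpos

/-- `(-Δ)^s u (x)` without its normalizing constant, written as an absolutely convergent integral
in the increment `z = y - x`. -/
noncomputable def fracIntegral (s : ℝ) (u : ℝ → ℝ) (x : ℝ) : ℝ :=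
  ∫ z : ℝ, (u x - u (x + z)) / |z| ^ (1 + 2 * s)

theorem fracIntegral_sub_const (s : ℝ) (u : ℝ → ℝ) (c x : ℝ) :
    fracIntegral s (fun w => u w - c) x = fracIntegral s u x := by
  simp only [fracIntegral, sub_sub_sub_cancel_right]

theorem fracIntegral_neg (s : ℝ) (u : ℝ → ℝ) (x : ℝ) :
    fracIntegral s (fun w => -u w) x = -fracIntegral s u x := by
  simp only [fracIntegral, ← integral_neg]
  congr! 2
  ring

theorem fracIntegral_comp_affine (s : ℝ) (u : ℝ → ℝ) {a : ℝ} (ha : a ≠ 0) (b x : ℝ) :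
    fracIntegral s (fun w => u (b + a * w)) x = |a| ^ (2 * s) * fracIntegral s u (b + a * x) := by
  have ha' : 0 < |a| := abs_pos.2 ha
  have hscale (z : ℝ) : (u (b + a * x) - u (b + a * (x + z))) / |z| ^ (1 + 2 * s) =
      |a| ^ (1 + 2 * s) *
        ((u (b + a * x) - u (b + a * x + a * z)) / |a * z| ^ (1 + 2 * s)) := by
    rw [abs_mul, mul_rpow ha'.le (abs_nonneg z), mul_add, ← add_assoc, ← mul_div_assoc,
      mul_div_mul_left _ _ (rpow_pos_of_pos ha' _).ne']
  simp only [fracIntegral, hscale]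
  rw [integral_const_mul, Measure.integral_comp_mul_left
    (fun z => (u (b + a * x) - u (b + a * x + z)) / |z| ^ (1 + 2 * s)), smul_eq_mul, abs_inv,
    rpow_add ha', rpow_one]
  field_simp

theorem continuous_of_abs_sub_le_rpow {p C : ℝ} {u : ℝ → ℝ} (hp : 0 < p)
    (hu : ∀ x y, |u x - u y| ≤ C * |x - y| ^ p) : Continuous u := by
  refine continuous_iff_continuousAt.2 fun x => tendsto_iff_dist_tendsto_zero.2 ?_
  have hlim : Tendsto (fun y => C * |y - x| ^ p) (𝓝 x) (𝓝 (C * |x - x| ^ p)) := by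
    have : Continuous fun y => C * |y - x| ^ p := by fun_prop (disch := exact hp.le)
    exact this.tendsto x
  rw [sub_self, abs_zero, zero_rpow hp.ne', mul_zero] at hlim
  exact squeeze_zero (fun _ => dist_nonneg) (fun y => hu y x) hlim

/-- Bounded functions that are Hölder continuous of exponent `p`, the two conditions being merged
into one bound on the increments. -/
def IsBoundedHolder (p : ℝ) (u : ℝ → ℝ) : Prop :=
  ∃ C, 0 ≤ C ∧ ∀ x y, |u x - u y| ≤ C * min (|x - y| ^ p) 1

namespace IsBoundedHolder

variable {s p : ℝ} {u : ℝ → ℝ}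

theorem continuous (hu : IsBoundedHolder p u) (hp : 0 < p) : Continuous u := by
  obtain ⟨C, hC, hu⟩ := hu
  exact continuous_of_abs_sub_le_rpow hp fun x y =>
    (hu x y).trans (by gcongr; exact min_le_left _ _)

theorem exists_abs_le (hu : IsBoundedHolder p u) : ∃ M, ∀ x, |u x| ≤ M := by
  obtain ⟨C, hC, hu⟩ := hu
  refine ⟨|u 0| + C, fun x => ?_⟩
  have hC1 : C * min (|x - 0| ^ p) 1 ≤ C := mul_le_of_le_one_right hC (min_le_right _ _)
  linarith [hu x 0, abs_sub_abs_le_abs_sub (u x) (u 0)]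

theorem comp_affine_sub_const (hu : IsBoundedHolder p u) (a b c : ℝ) :
    IsBoundedHolder p fun w => u (b + a * w) - c := by
  obtain ⟨C, hC, hu⟩ := hu
  refine ⟨C * max (|a| ^ p) 1, by positivity, fun x y => ?_⟩
  have hxy := hu (b + a * x) (b + a * y)
  rw [add_sub_add_left_eq_sub, ← mul_sub, abs_mul, mul_rpow (abs_nonneg a) (abs_nonneg _)] at hxy
  rw [sub_sub_sub_cancel_right, mul_assoc]
  refine hxy.trans (mul_le_mul_of_nonneg_left ?_ hC)
  rw [mul_min_of_nonneg _ _ (by positivity), mul_one]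
  exact min_le_min (by gcongr; exact le_max_left _ _) (le_max_right _ _)

theorem exists_norm_fracIntegrand_le (hu : IsBoundedHolder p u) (s : ℝ) :
    ∃ C, ∀ x z, ‖(u x - u (x + z)) / |z| ^ (1 + 2 * s)‖ ≤
      C * (min (|z| ^ p) 1 / |z| ^ (1 + 2 * s)) := by
  obtain ⟨C, -, hu⟩ := hu
  refine ⟨C, fun x z => ?_⟩
  have hz := hu x (x + z)
  rw [sub_add_cancel_left, abs_neg] at hz
  rw [norm_div, norm_eq_abs, norm_of_nonneg (by positivity), ← mul_div_assoc]
  gcongr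

theorem integrable_fracIntegrand (hu : IsBoundedHolder p u) (hs : 0 < s) (hp : 2 * s < p)
    (x : ℝ) : Integrable fun z : ℝ => (u x - u (x + z)) / |z| ^ (1 + 2 * s) := by
  obtain ⟨C, hC⟩ := hu.exists_norm_fracIntegrand_le s
  have := (hu.continuous (by linarith)).measurable
  refine ((integrable_min_rpow_one_div_rpow (by linarith) hp).const_mul C).mono' ?_
    (ae_of_all _ (hC x))
  apply Measurable.aestronglyMeasurable
  fun_prop

theorem continuous_fracIntegral (hu : IsBoundedHolder p u) (hs : 0 < s) (hp : 2 * s < p) :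
    Continuous (fracIntegral s u) := by
  obtain ⟨C, hC⟩ := hu.exists_norm_fracIntegrand_le s
  have hcont := hu.continuous (by linarith)
  exact continuous_of_dominated
    (fun x => (hu.integrable_fracIntegrand hs hp x).aestronglyMeasurable)
    (fun x => ae_of_all _ (hC x))
    ((integrable_min_rpow_one_div_rpow (by linarith) hp).const_mul C)
    (ae_of_all _ fun z => by fun_prop)

theorem hasFracLaplacianAt (hu : IsBoundedHolder p u) (hs : 0 < s) (hp : 2 * s < p) (x : ℝ) :
    HasFracLaplacianAt s u x (fracLaplacianConst s * fracIntegral s u x) := by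
  have hshift : (fun z => (u x - u (x + z)) / |x - (x + z)| ^ (1 + 2 * s)) =
      fun z => (u x - u (x + z)) / |z| ^ (1 + 2 * s) := by
    simp only [sub_add_cancel_left, abs_neg]
  have hint : Integrable fun y => (u x - u y) / |x - y| ^ (1 + 2 * s) := by
    have := hu.integrable_fracIntegrand hs hp x
    rw [← hshift] at this
    simpa only [add_sub_cancel] using this.comp_sub_right x
  have hval : fracIntegral s u x = ∫ y, (u x - u y) / |x - y| ^ (1 + 2 * s) := by
    rw [fracIntegral, ← hshift,
      integral_add_left_eq_self (fun y => (u x - u y) / |x - y| ^ (1 + 2 * s))]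
  have hcover : AECover volume (𝓝[>] 0) fun δ : ℝ => {y : ℝ | δ < |x - y|} := by
    refine ⟨?_, fun δ => measurableSet_lt measurable_const (by fun_prop)⟩
    filter_upwards [Measure.ae_ne volume x] with y hy
    exact nhdsWithin_le_nhds (Iio_mem_nhds (abs_pos.2 (sub_ne_zero.2 hy.symm)))
  rw [hval]
  exact ⟨fun δ _ => hint.integrableOn,
    (hcover.integral_tendsto_of_countably_generated hint).const_mul _⟩

end IsBoundedHolder

theorem integrable_min_abs_div_rpow {q r : ℝ} (hq : 0 < q) (hq1 : q < 1) (hr : 0 ≤ r)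
    (hr1 : r ≤ 1) : Integrable fun z : ℝ => min r |z| / |z| ^ (1 + q) := by
  refine (integrable_min_rpow_one_div_rpow hq hq1).mono' ?_ (ae_of_all _ fun z => ?_)
  · apply Measurable.aestronglyMeasurable
    fun_prop
  · rw [norm_of_nonneg (by positivity), rpow_one, min_comm]
    gcongr

theorem integral_min_abs_div_rpow (q : ℝ) {r : ℝ} (hr : 0 < r) :
    ∫ z : ℝ, min r |z| / |z| ^ (1 + q) =
      r ^ (1 - q) * ∫ z : ℝ, min 1 |z| / |z| ^ (1 + q) := by
  have hscale (z : ℝ) : min r |r * z| / |r * z| ^ (1 + q) =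
      r ^ (-q) * (min 1 |z| / |z| ^ (1 + q)) := by
    rw [abs_mul, abs_of_pos hr, mul_rpow hr.le (abs_nonneg z), rpow_add hr, rpow_one,
      rpow_neg hr.le, ← mul_div_mul_left (min 1 |z|) _ hr.ne', mul_min_of_nonneg _ _ hr.le, mul_one]
    field_simp
  have hint := Measure.integral_comp_mul_left (fun z : ℝ => min r |z| / |z| ^ (1 + q)) r
  simp_rw [hscale] at hint
  rw [integral_const_mul, abs_of_pos (inv_pos.2 hr), smul_eq_mul, eq_inv_mul_iff_mul_eq₀ hr.ne']
    at hint
  rw [← hint, sub_eq_add_neg, rpow_add hr, rpow_one, mul_assoc]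

/-! ### The fractional Laplacian at unit scale -/

theorem abs_rpow_neg_sub_rpow_neg_le {q τ a b : ℝ} (hq : 0 ≤ q) (hτ : 0 < τ) (ha : τ ≤ a)
    (hb : τ ≤ b) : |a ^ (-q) - b ^ (-q)| ≤ q * τ ^ (-q - 1) * |a - b| := by
  have hderiv (t : ℝ) (ht : t ∈ Ici τ) :
      HasDerivWithinAt (fun t : ℝ => t ^ (-q)) (-q * t ^ (-q - 1)) (Ici τ) t :=
    (hasDerivAt_rpow_const (Or.inl (hτ.trans_le ht).ne')).hasDerivWithinAt
  refine (convex_Ici τ).norm_image_sub_le_of_norm_hasDerivWithin_le hderiv (fun t ht => ?_) hb ha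
  have ht0 : 0 < t := hτ.trans_le ht
  rw [norm_mul, norm_neg, norm_of_nonneg hq, norm_of_nonneg (by positivity)]
  exact mul_le_mul_of_nonneg_left (rpow_le_rpow_of_nonpos hτ ht (by linarith)) hq

/-- The kernel `|z|^(-q)`, levelled off on `|z| ≤ 1/4`. Splitting it off from `|z|^(-q)` leaves a
kernel supported near the origin, while the difference quotients of the cut kernel itself are
controlled everywhere. -/
noncomputable def cutKernel (q z : ℝ) : ℝ := max |z| (1 / 4) ^ (-q)

theorem cutKernel_nonneg (q z : ℝ) : 0 ≤ cutKernel q z := by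
  unfold cutKernel
  positivity

theorem continuous_cutKernel (q : ℝ) : Continuous (cutKernel q) := by
  unfold cutKernel
  exact Continuous.rpow_const (by fun_prop) fun z => Or.inl (by positivity)

theorem integrable_cutKernel {q : ℝ} (hq : 1 < q) : Integrable (cutKernel q) := by
  have hdecay : Integrable fun z : ℝ => (1 / 5 : ℝ) ^ (-q) * (1 + ‖z‖) ^ (-q) :=
    (integrable_one_add_norm (by simpa using hq)).const_mul _
  refine hdecay.mono' (continuous_cutKernel q).aestronglyMeasurable (ae_of_all _ fun z => ?_)
  rw [norm_of_nonneg (cutKernel_nonneg q z), cutKernel, norm_eq_abs,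
    ← mul_rpow (by norm_num) (by positivity)]
  refine rpow_le_rpow_of_nonpos (by positivity) ?_ (by linarith)
  linarith [le_max_left |z| (1 / 4), le_max_right |z| (1 / 4)]

theorem cutKernel_of_le {q z : ℝ} (hz : 1 / 4 ≤ |z|) : cutKernel q z = 1 / |z| ^ q := by
  rw [cutKernel, max_eq_left hz, rpow_neg (abs_nonneg z), one_div]

theorem cutKernel_le {q z : ℝ} (hq : 0 ≤ q) (hz : z ≠ 0) : cutKernel q z ≤ 1 / |z| ^ q := by
  rw [cutKernel, one_div (|z| ^ q), ← rpow_neg (abs_nonneg z)]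
  exact rpow_le_rpow_of_nonpos (abs_pos.2 hz) (le_max_left _ _) (by linarith)

theorem abs_cutKernel_sub_le {q h w : ℝ} (hq : 0 ≤ q) (hh : 0 ≤ h) (hh1 : h ≤ 1) :
    |cutKernel q w - cutKernel q (w - h)| ≤
      q * (1 / 9 : ℝ) ^ (-q - 1) * (1 + |w|) ^ (-q - 1) * h := by
  have htri : |w| - |w - h| ≤ h := by
    simpa [abs_of_nonneg hh] using abs_sub_abs_le_abs_sub w (w - h)
  have hw := le_max_left |w| (1 / 4)
  have hw4 := le_max_right |w| (1 / 4)
  have hwh := le_max_left |w - h| (1 / 4)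
  have hwh4 := le_max_right |w - h| (1 / 4)
  have hpow := abs_rpow_neg_sub_rpow_neg_le hq (τ := 1 / 9 * (1 + |w|)) (by positivity)
    (a := max |w| (1 / 4)) (b := max |w - h| (1 / 4)) (by linarith) (by linarith)
  rw [mul_rpow (by norm_num) (by positivity), ← mul_assoc] at hpow
  refine hpow.trans (mul_le_mul_of_nonneg_left ?_ (by positivity))
  refine (abs_max_sub_max_le_abs _ _ _).trans ((abs_abs_sub_abs_le _ _).trans ?_)
  rw [sub_sub_cancel, abs_of_nonneg hh]

section UnitScale

variable {s p A h : ℝ} {U : ℝ → ℝ}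

theorem norm_increment_sub_mul_le (hs : 0 < s) (hh : 0 ≤ h) (hA : 0 ≤ A)
    (hlip : ∀ v ∈ Icc (-1 / 4) (h + 1 / 4), ∀ w ∈ Icc (-1 / 4) (h + 1 / 4),
      |U v - U w| ≤ A * |v - w|) (z : ℝ) :
    ‖((U 0 - U z) - (U h - U (h + z))) * (1 / |z| ^ (1 + 2 * s) - cutKernel (1 + 2 * s) z)‖ ≤
      2 * A * (min h |z| / |z| ^ (1 + 2 * s)) := by
  rcases eq_or_ne z 0 with rfl | hz
  · simpa using by positivity
  rcases le_total (1 / 4) |z| with hz4 | hz4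
  · rw [cutKernel_of_le hz4, sub_self, mul_zero, norm_zero]
    positivity
  obtain ⟨hz1, hz2⟩ := abs_le.1 hz4
  have hkernel := cutKernel_le (q := 1 + 2 * s) (by linarith) hz
  have hbase := hlip h ⟨by linarith, by linarith⟩ 0 ⟨by linarith, by linarith⟩
  have hshifted := hlip (h + z) ⟨by linarith, by linarith⟩ z ⟨by linarith, by linarith⟩
  have hleft := hlip z ⟨by linarith, by linarith⟩ 0 ⟨by linarith, by linarith⟩
  have hright := hlip (h + z) ⟨by linarith, by linarith⟩ h ⟨by linarith, by linarith⟩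
  rw [sub_zero, abs_of_nonneg hh] at hbase
  rw [add_sub_cancel_right, abs_of_nonneg hh] at hshifted
  rw [sub_zero] at hleft
  rw [add_sub_cancel_left] at hright
  have hincr : |(U 0 - U z) - (U h - U (h + z))| ≤ 2 * A * min h |z| := by
    rw [mul_min_of_nonneg _ _ (by positivity), le_min_iff]
    rw [abs_le] at hbase hshifted hleft hright
    exact ⟨abs_le.2 ⟨by linarith, by linarith⟩, abs_le.2 ⟨by linarith, by linarith⟩⟩
  rw [norm_mul, norm_eq_abs, norm_of_nonneg (sub_nonneg.2 hkernel)]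
  calc _ ≤ 2 * A * min h |z| * (1 / |z| ^ (1 + 2 * s)) := by
        gcongr
        exact sub_le_self _ (cutKernel_nonneg _ z)
    _ = _ := by ring

theorem norm_mul_cutKernel_sub_le (hs : 0 < s) (hh : 0 ≤ h) (hh1 : h ≤ 1) (hA : 0 ≤ A)
    (hgrow : ∀ w, |U w| ≤ A * (1 + |w|) ^ (1 + s)) (w : ℝ) :
    ‖U w * (cutKernel (1 + 2 * s) w - cutKernel (1 + 2 * s) (w - h))‖ ≤
      (1 + 2 * s) * (1 / 9 : ℝ) ^ (-(1 + 2 * s) - 1) * A * h * (1 + ‖w‖) ^ (-(1 + s)) := by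
  have hpow : (1 + |w|) ^ (-(1 + s)) =
      (1 + |w|) ^ (1 + s) * (1 + |w|) ^ (-(1 + 2 * s) - 1) := by
    rw [← rpow_add (by positivity)]
    ring_nf
  rw [norm_mul, norm_eq_abs, norm_eq_abs, norm_eq_abs, hpow]
  calc _ ≤ A * (1 + |w|) ^ (1 + s) * ((1 + 2 * s) * (1 / 9 : ℝ) ^ (-(1 + 2 * s) - 1) *
        (1 + |w|) ^ (-(1 + 2 * s) - 1) * h) :=
        mul_le_mul (hgrow w) (abs_cutKernel_sub_le (by linarith) hh hh1) (abs_nonneg _)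
          (by positivity)
    _ = _ := by ring

theorem IsBoundedHolder.integrable_mul_cutKernel (hU : IsBoundedHolder p U) (hp : 0 < p)
    {q : ℝ} (hq : 1 < q) (a : ℝ) : Integrable fun w => U w * cutKernel q (w - a) := by
  obtain ⟨M, hM⟩ := hU.exists_abs_le
  have hcont := hU.continuous hp
  exact ((integrable_cutKernel hq).comp_sub_right a).bdd_mul hcont.aestronglyMeasurable
    (ae_of_all _ hM)

theorem IsBoundedHolder.integrable_sub_mul_cutKernel (hU : IsBoundedHolder p U) (hp : 0 < p)
    {q : ℝ} (hq : 1 < q) (x : ℝ) : Integrable fun z => (U x - U (x + z)) * cutKernel q z := by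
  have hUk := (hU.integrable_mul_cutKernel hp hq x).comp_add_left x
  simp only [add_sub_cancel_left] at hUk
  simp only [sub_mul]
  exact ((integrable_cutKernel hq).const_mul (U x)).sub hUk

theorem IsBoundedHolder.integrable_sub_mul_sub_cutKernel (hU : IsBoundedHolder p U) (hs : 0 < s)
    (hp : 2 * s < p) (x : ℝ) : Integrable fun z =>
      (U x - U (x + z)) * (1 / |z| ^ (1 + 2 * s) - cutKernel (1 + 2 * s) z) := by
  simp only [mul_sub (U x - _), mul_one_div]
  exact (hU.integrable_fracIntegrand hs hp x).sub
    (hU.integrable_sub_mul_cutKernel (by linarith) (by linarith) x)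

theorem IsBoundedHolder.fracIntegral_eq_near_add_far (hU : IsBoundedHolder p U) (hs : 0 < s)
    (hp : 2 * s < p) (x : ℝ) :
    fracIntegral s U x =
      (∫ z, (U x - U (x + z)) * (1 / |z| ^ (1 + 2 * s) - cutKernel (1 + 2 * s) z)) +
      (U x * (∫ z, cutKernel (1 + 2 * s) z) - ∫ w, U w * cutKernel (1 + 2 * s) (w - x)) := by
  have hk := integrable_cutKernel (q := 1 + 2 * s) (by linarith)
  have hUk := hU.integrable_mul_cutKernel (by linarith) (q := 1 + 2 * s) (by linarith) x
  have hUk' := hUk.comp_add_left x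
  have hfar : ∫ z, (U x - U (x + z)) * cutKernel (1 + 2 * s) z =
      U x * (∫ z, cutKernel (1 + 2 * s) z) - ∫ w, U w * cutKernel (1 + 2 * s) (w - x) := by
    rw [← integral_add_left_eq_self (fun w => U w * cutKernel (1 + 2 * s) (w - x)) x,
      ← integral_const_mul, ← integral_sub (hk.const_mul _) hUk']
    simp only [sub_mul, add_sub_cancel_left]
  rw [← hfar, ← integral_add (hU.integrable_sub_mul_sub_cutKernel hs hp x)
    (hU.integrable_sub_mul_cutKernel (by linarith) (by linarith) x), fracIntegral]
  simp only [mul_sub, sub_add_cancel, mul_one_div]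

theorem IsBoundedHolder.fracIntegral_sub_eq (hU : IsBoundedHolder p U) (hs : 0 < s)
    (hp : 2 * s < p) (x y : ℝ) :
    fracIntegral s U x - fracIntegral s U y =
      (∫ z, ((U x - U (x + z)) - (U y - U (y + z))) *
        (1 / |z| ^ (1 + 2 * s) - cutKernel (1 + 2 * s) z)) +
      (U x - U y) * (∫ z, cutKernel (1 + 2 * s) z) -
      ∫ w, U w * (cutKernel (1 + 2 * s) (w - x) - cutKernel (1 + 2 * s) (w - y)) := by
  have hfar := hU.integrable_mul_cutKernel (q := 1 + 2 * s) (by linarith) (by linarith)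
  simp only [hU.fracIntegral_eq_near_add_far hs hp, mul_sub (U _), sub_mul (U x - _)]
  rw [integral_sub (hU.integrable_sub_mul_sub_cutKernel hs hp x)
    (hU.integrable_sub_mul_sub_cutKernel hs hp y), integral_sub (hfar x) (hfar y)]
  ring

theorem abs_integral_increment_sub_mul_le (hs : 0 < s) (hs1 : 2 * s < 1) (hh : 0 < h)
    (hh1 : h ≤ 1) (hA : 0 ≤ A)
    (hlip : ∀ v ∈ Icc (-1 / 4) (h + 1 / 4), ∀ w ∈ Icc (-1 / 4) (h + 1 / 4),
      |U v - U w| ≤ A * |v - w|) :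
    |∫ z, ((U 0 - U z) - (U h - U (h + z))) *
        (1 / |z| ^ (1 + 2 * s) - cutKernel (1 + 2 * s) z)| ≤
      2 * (∫ z : ℝ, min 1 |z| / |z| ^ (1 + 2 * s)) * (A * h ^ (1 - 2 * s)) := by
  calc _ ≤ ∫ z : ℝ, 2 * A * (min h |z| / |z| ^ (1 + 2 * s)) :=
        norm_integral_le_of_norm_le
          ((integrable_min_abs_div_rpow (by linarith) hs1 hh.le hh1).const_mul _)
          (ae_of_all _ (norm_increment_sub_mul_le hs hh.le hA hlip))
    _ = _ := by
        rw [integral_const_mul, integral_min_abs_div_rpow _ hh]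
        ring

theorem abs_integral_mul_cutKernel_sub_le (hs : 0 < s) (hh : 0 ≤ h) (hh1 : h ≤ 1) (hA : 0 ≤ A)
    (hgrow : ∀ w, |U w| ≤ A * (1 + |w|) ^ (1 + s)) :
    |∫ w, U w * (cutKernel (1 + 2 * s) w - cutKernel (1 + 2 * s) (w - h))| ≤
      (1 + 2 * s) * (1 / 9 : ℝ) ^ (-(1 + 2 * s) - 1) *
        (∫ w : ℝ, (1 + ‖w‖) ^ (-(1 + s))) * (A * h) := by
  have hdecay : Integrable fun w : ℝ => (1 + ‖w‖) ^ (-(1 + s)) :=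
    integrable_one_add_norm (by simpa using hs)
  refine (norm_integral_le_of_norm_le (hdecay.const_mul _)
    (ae_of_all _ (norm_mul_cutKernel_sub_le hs hh hh1 hA hgrow))).trans_eq ?_
  rw [integral_const_mul]
  ring

theorem exists_abs_fracIntegral_sub_le (hs : 0 < s) (hs1 : 2 * s < 1) (hp : 2 * s < p) :
    ∃ K, 0 ≤ K ∧ ∀ {A h : ℝ} {U : ℝ → ℝ}, IsBoundedHolder p U → 0 < h → h ≤ 1 → 0 ≤ A →
      (∀ w, |U w| ≤ A * (1 + |w|) ^ (1 + s)) →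
      (∀ v ∈ Icc (-1 / 4) (h + 1 / 4), ∀ w ∈ Icc (-1 / 4) (h + 1 / 4),
        |U v - U w| ≤ A * |v - w|) →
      |fracIntegral s U 0 - fracIntegral s U h| ≤ K * (A * h ^ (1 - 2 * s)) := by
  set k := cutKernel (1 + 2 * s)
  set near := 2 * ∫ z : ℝ, min 1 |z| / |z| ^ (1 + 2 * s)
  set far := (1 + 2 * s) * (1 / 9 : ℝ) ^ (-(1 + 2 * s) - 1) * ∫ w : ℝ, (1 + ‖w‖) ^ (-(1 + s))
  have : 0 ≤ near := by positivity
  have hk0 : 0 ≤ ∫ z, k z := integral_nonneg (cutKernel_nonneg _)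
  have : 0 ≤ far := by positivity
  refine ⟨near + (∫ z, k z) + far, by positivity, fun {A h U} hU hh hh1 hA hgrow hlip => ?_⟩
  have hsplit := hU.fracIntegral_sub_eq hs hp 0 h
  simp only [zero_add, sub_zero] at hsplit
  have hbase : |(U 0 - U h) * ∫ z, k z| ≤ (∫ z, k z) * (A * h) := by
    rw [abs_mul, abs_of_nonneg hk0, mul_comm]
    have := hlip 0 ⟨by linarith, by linarith⟩ h ⟨by linarith, by linarith⟩
    rw [zero_sub, abs_neg, abs_of_pos hh] at this
    gcongr
  have hpow : A * h ≤ A * h ^ (1 - 2 * s) := by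
    gcongr
    simpa using rpow_le_rpow_of_exponent_ge hh hh1 (by linarith : 1 - 2 * s ≤ 1)
  rw [hsplit, add_mul, add_mul]
  refine (abs_sub _ _).trans (add_le_add ((abs_add_le _ _).trans (add_le_add ?_ ?_)) ?_)
  · exact abs_integral_increment_sub_mul_le hs hs1 hh hh1 hA hlip
  · exact hbase.trans (by gcongr)
  · exact (abs_integral_mul_cutKernel_sub_le hs hh.le hh1 hA hgrow).trans (by gcongr)

end UnitScale

/-! ### Hölder control of one function by another -/

/-- `H` is a `β`-Hölder function of `u` on `S`; in particular it factors through `u` there. -/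
def HolderControlledOn (β : ℝ) (u H : ℝ → ℝ) (S : Set ℝ) : Prop :=
  ∃ K, 0 ≤ K ∧ ∀ x ∈ S, ∀ y ∈ S, |H x - H y| ≤ K * |u x - u y| ^ β

namespace HolderControlledOn

variable {β : ℝ} {u H : ℝ → ℝ} {S : Set ℝ}

theorem of_lt {K : ℝ} (hK : 0 ≤ K)
    (h : ∀ x ∈ S, ∀ y ∈ S, x < y → |H x - H y| ≤ K * |u x - u y| ^ β) :
    HolderControlledOn β u H S := by
  refine ⟨K, hK, fun x hx y hy => ?_⟩
  rcases lt_trichotomy x y with hxy | rfl | hxy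
  · exact h x hx y hy hxy
  · rw [sub_self, abs_zero]
    positivity
  · rw [abs_sub_comm, abs_sub_comm (u x)]
    exact h y hy x hx hxy

theorem const_mul (h : HolderControlledOn β u H S) (c : ℝ) :
    HolderControlledOn β u (fun x => c * H x) S := by
  obtain ⟨K, hK, h⟩ := h
  refine ⟨|c| * K, by positivity, fun x hx y hy => ?_⟩
  rw [← mul_sub, abs_mul, mul_assoc]
  exact mul_le_mul_of_nonneg_left (h x hx y hy) (abs_nonneg c)

theorem reflect (h : HolderControlledOn β u H S) {c : ℝ} (hu : ∀ x, u (c - x) = -u x)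
    (hH : ∀ x, H (c - x) = -H x) : HolderControlledOn β u H ((c - ·) ⁻¹' S) := by
  obtain ⟨K, hK, h⟩ := h
  refine ⟨K, hK, fun x hx y hy => ?_⟩
  simpa only [hu, hH, neg_sub_neg, abs_sub_comm] using h _ hx _ hy

theorem Icc_union {a m b : ℝ} (hleft : HolderControlledOn β u H (Icc a m))
    (hright : HolderControlledOn β u H (Icc m b)) (hβ : 0 ≤ β) (hu : MonotoneOn u (Icc a b)) :
    HolderControlledOn β u H (Icc a b) := by
  obtain ⟨K, hK, hleft⟩ := hleft
  obtain ⟨L, hL, hright⟩ := hright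
  refine of_lt (add_nonneg hK hL) fun x hx y hy hxy => ?_
  have hpow : 0 ≤ |u x - u y| ^ β := by positivity
  rcases le_total y m with hym | hmy
  · have := hleft x ⟨hx.1, hxy.le.trans hym⟩ y ⟨hy.1, hym⟩
    nlinarith
  rcases le_total m x with hmx | hxm
  · have := hright x ⟨hmx, hx.2⟩ y ⟨hmy, hy.2⟩
    nlinarith
  have hm : m ∈ Icc a b := ⟨hx.1.trans hxm, hmy.trans hy.2⟩
  have hum : u m ∈ uIcc (u x) (u y) := mem_uIcc_of_le (hu hx hm hxm) (hu hm hy hmy)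
  have hxm' : |u x - u m| ≤ |u x - u y| := by
    rw [abs_sub_comm, abs_sub_comm (u x)]
    exact abs_sub_left_of_mem_uIcc hum
  have hmy' : |u m - u y| ≤ |u x - u y| := by
    rw [abs_sub_comm, abs_sub_comm (u x)]
    exact abs_sub_right_of_mem_uIcc hum
  calc |H x - H y| ≤ |H x - H m| + |H m - H y| := abs_sub_le _ _ _
    _ ≤ K * |u x - u m| ^ β + L * |u m - u y| ^ β :=
        add_le_add (hleft x ⟨hx.1, hxm⟩ m ⟨hm.1, le_rfl⟩) (hright m ⟨le_rfl, hm.2⟩ y ⟨hmy, hy.2⟩)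
    _ ≤ K * |u x - u y| ^ β + L * |u x - u y| ^ β := by gcongr
    _ = (K + L) * |u x - u y| ^ β := by ring

theorem of_forall_exists (h : HolderControlledOn β u H S)
    (hrep : ∀ x, ∃ y ∈ S, u y = u x ∧ H y = H x) : HolderControlledOn β u H univ := by
  obtain ⟨K, hK, h⟩ := h
  refine ⟨K, hK, fun x _ y _ => ?_⟩
  obtain ⟨x', hx', hux, hHx⟩ := hrep x
  obtain ⟨y', hy', huy, hHy⟩ := hrep y
  rw [← hux, ← huy, ← hHx, ← hHy]
  exact h x' hx' y' hy'

end HolderControlledOn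

theorem nonpos_of_le_half {a : ℝ} {F G : ℝ → ℝ} (hhalf : ∀ x ∈ Ioc 0 a, F x ≤ F (x / 2))
    (hFG : ∀ x ∈ Ioc 0 a, F x ≤ G x) (hG : Tendsto G (𝓝[>] 0) (𝓝 0)) {x : ℝ}
    (hx : x ∈ Ioc 0 a) : F x ≤ 0 := by
  have hmem (n : ℕ) : x / 2 ^ n ∈ Ioc 0 a :=
    ⟨div_pos hx.1 (by positivity), (div_le_self hx.1.le (one_le_pow₀ one_le_two)).trans hx.2⟩
  have hiter (n : ℕ) : F x ≤ F (x / 2 ^ n) := by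
    induction n with
    | zero => simp
    | succ n ih =>
      rw [pow_succ, ← div_div]
      exact ih.trans (hhalf _ (hmem n))
  have hlim : Tendsto (fun n : ℕ => x / 2 ^ n) atTop (𝓝[>] 0) :=
    tendsto_nhdsWithin_iff.2 ⟨tendsto_const_nhds.div_atTop
      (tendsto_pow_atTop_atTop_of_one_lt one_lt_two), Eventually.of_forall fun n => (hmem n).1⟩
  exact ge_of_tendsto' (hG.comp hlim) fun n => (hiter n).trans (hFG _ (hmem n))

section Dyadic

variable {β a q K : ℝ} {u H : ℝ → ℝ}

theorem abs_sub_zero_le_of_dyadic (hβ : 0 < β) (hq0 : 0 ≤ q) (hq1 : q < 1) (hK : 0 ≤ K)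
    (hH : ContinuousAt H 0) (hmono : MonotoneOn u (Icc 0 a))
    (hhalf : ∀ x ∈ Ioc 0 a, u (x / 2) - u 0 ≤ q * (u x - u 0))
    (hloc : ∀ x y, 0 < x → x < y → y ≤ 2 * x → y ≤ a → |H x - H y| ≤ K * |u x - u y| ^ β)
    {x : ℝ} (hx : x ∈ Icc 0 a) : |H x - H 0| ≤ K / (1 - q ^ β) * (u x - u 0) ^ β := by
  have hqβ : 0 < 1 - q ^ β := sub_pos.2 (rpow_lt_one hq0 hq1 hβ)
  set L := K / (1 - q ^ β)
  have hL : 0 ≤ L := by positivity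
  have hKL : K = L * (1 - q ^ β) := (div_mul_cancel₀ K hqβ.ne').symm
  have hmono0 {t : ℝ} (ht : t ∈ Icc 0 a) : 0 ≤ u t - u 0 :=
    sub_nonneg.2 (hmono ⟨le_rfl, ht.1.trans ht.2⟩ ht ht.1)
  rcases hx.1.eq_or_lt with rfl | hx0
  · rw [sub_self, sub_self, abs_zero, zero_rpow hβ.ne', mul_zero]
  refine sub_nonpos.1 (nonpos_of_le_half (F := fun t => |H t - H 0| - L * (u t - u 0) ^ β)
    (G := fun t => |H t - H 0|) (fun t ht => ?_)
    (fun t ht => sub_le_self _ (mul_nonneg hL (rpow_nonneg (hmono0 ⟨ht.1.le, ht.2⟩) _)))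
    ?_ ⟨hx0, hx.2⟩)
  · obtain ⟨ht0, hta⟩ := ht
    have ht2 : t / 2 ∈ Icc 0 a := ⟨by linarith, by linarith⟩
    have hstep : |H (t / 2) - H t| ≤ K * (u t - u 0) ^ β := by
      refine (hloc (t / 2) t (by linarith) (by linarith) (by linarith) hta).trans ?_
      have hu2 : u (t / 2) ≤ u t := hmono ht2 ⟨ht0.le, hta⟩ (by linarith)
      rw [abs_sub_comm, abs_of_nonneg (sub_nonneg.2 hu2)]
      have := hmono0 ht2
      gcongr
      linarith
    have hcontract : L * (u (t / 2) - u 0) ^ β ≤ L * (q ^ β * (u t - u 0) ^ β) := by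
      rw [← mul_rpow hq0 (hmono0 ⟨ht0.le, hta⟩)]
      have := hmono0 ht2
      gcongr
      exact hhalf t ⟨ht0, hta⟩
    rw [hKL] at hstep
    linarith [abs_sub_le (H t) (H (t / 2)) (H 0), abs_sub_comm (H t) (H (t / 2))]
  · have hlim : Tendsto (fun t => |H t - H 0|) (𝓝 0) (𝓝 |H 0 - H 0|) := (hH.sub_const _).abs
    rw [sub_self, abs_zero] at hlim
    exact hlim.mono_left nhdsWithin_le_nhds

theorem holderControlledOn_Icc_of_dyadic (hβ : 0 < β) (hq0 : 0 ≤ q) (hq1 : q < 1) (hK : 0 ≤ K)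
    (hH : ContinuousAt H 0) (hmono : MonotoneOn u (Icc 0 a))
    (hhalf : ∀ x ∈ Ioc 0 a, u (x / 2) - u 0 ≤ q * (u x - u 0))
    (hloc : ∀ x y, 0 < x → x < y → y ≤ 2 * x → y ≤ a → |H x - H y| ≤ K * |u x - u y| ^ β) :
    HolderControlledOn β u H (Icc 0 a) := by
  have hqβ : 0 < 1 - q ^ β := sub_pos.2 (rpow_lt_one hq0 hq1 hβ)
  have hq1' : 0 < 1 - q := sub_pos.2 hq1
  set L := K / (1 - q ^ β)
  have hzero {x : ℝ} (hx : x ∈ Icc 0 a) : |H x - H 0| ≤ L * (u x - u 0) ^ β :=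
    abs_sub_zero_le_of_dyadic hβ hq0 hq1 hK hH hmono hhalf hloc hx
  refine .of_lt (K := K + 2 * L * (1 - q)⁻¹ ^ β) (by positivity) fun x hx y hy hxy => ?_
  rcases le_or_gt y (2 * x) with hy2 | hy2
  · refine (hloc x y (by linarith [hy.1]) hxy hy2 hy.2).trans ?_
    gcongr
    exact le_add_of_nonneg_right (by positivity)
  have hy0 : 0 < y := hx.1.trans_lt hxy
  have hu0x : u 0 ≤ u x := hmono ⟨le_rfl, hx.1.trans hx.2⟩ hx hx.1
  have hxy2 : u x ≤ u (y / 2) := hmono hx ⟨by linarith, by linarith [hy.2]⟩ (by linarith)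
  have huxy : u x ≤ u y := hmono hx hy hxy.le
  have hfar : u y - u 0 ≤ (1 - q)⁻¹ * |u x - u y| := by
    rw [abs_sub_comm, abs_of_nonneg (sub_nonneg.2 huxy), le_inv_mul_iff₀ hq1']
    linarith [hhalf y ⟨hy0, hy.2⟩]
  calc |H x - H y| ≤ |H x - H 0| + |H 0 - H y| := abs_sub_le _ _ _
    _ ≤ L * (u x - u 0) ^ β + L * (u y - u 0) ^ β := by
        rw [abs_sub_comm (H 0)]
        exact add_le_add (hzero hx) (hzero hy)
    _ ≤ L * (u y - u 0) ^ β + L * (u y - u 0) ^ β := by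
        have := sub_nonneg.2 hu0x
        gcongr
    _ = 2 * L * (u y - u 0) ^ β := by ring
    _ ≤ 2 * L * ((1 - q)⁻¹ * |u x - u y|) ^ β := by
        have := hu0x.trans huxy
        gcongr
    _ = 2 * L * (1 - q)⁻¹ ^ β * |u x - u y| ^ β := by
        rw [mul_rpow (by positivity) (abs_nonneg _), mul_assoc (2 * L)]
    _ ≤ (K + 2 * L * (1 - q)⁻¹ ^ β) * |u x - u y| ^ β := by
        gcongr
        exact le_add_of_nonneg_left hK

end Dyadic

/-! ### Fractional integrals of dyadic profiles -/

/-- On `(0, a]`, uniformly over dyadic scales, `u - u 0` increases like its size function `m`: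
at each scale `x` its growth, Lipschitz constant and slope are those of a function of size `m x`
on an interval of length `x`. The growth exponent `1 + s` is admissible because differences of the
kernel `|z|^(-1-2s)` decay like `|z|^(-2-2s)`; the margins beyond `[x, 2x]` and `[0, a]` leave room
for a neighbourhood of radius `x / 4` around the points compared. -/
structure DyadicProfile (s a A c : ℝ) (m u : ℝ → ℝ) : Prop where
  A_pos : 0 < A
  c_pos : 0 < c
  pos : ∀ x ∈ Ioc 0 a, 0 < m x
  mono : MonotoneOn u (Icc 0 (5 / 4 * a))
  growth : ∀ x ∈ Ioc 0 a, ∀ w, |u w - u 0| ≤ A * m x * (1 + |w| / x) ^ (1 + s)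
  lipschitz : ∀ x ∈ Ioc 0 a, ∀ w v, 3 / 4 * x ≤ w → w ≤ v → v ≤ 9 / 4 * x → v ≤ 5 / 4 * a →
    u v - u w ≤ A * m x / x * (v - w)
  lower : ∀ x y, 0 < x → x ≤ y → y ≤ 2 * x → y ≤ a → c * m x * ((y - x) / x) ≤ u y - u x

namespace DyadicProfile

variable {s p β a A c x y : ℝ} {m u : ℝ → ℝ}

theorem abs_rescaled_le (h : DyadicProfile s a A c m u) (hs0 : 0 < s) (hs1 : s ≤ 1)
    (hx : x ∈ Ioc 0 a) (w : ℝ) :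
    |u (x + x * w) - u 0| ≤ 4 * A * m x * (1 + |w|) ^ (1 + s) := by
  have hA := h.A_pos
  have hm := h.pos x hx
  have hx0 := hx.1
  have hbase : 1 + |x + x * w| / x ≤ 2 * (1 + |w|) := by
    rw [← mul_one_add, abs_mul, abs_of_pos hx0, mul_div_cancel_left₀ _ hx0.ne']
    linarith [abs_add_le 1 w, abs_one (α := ℝ), abs_nonneg w]
  have htwo : (2 : ℝ) ^ (1 + s) ≤ 4 :=
    (rpow_le_rpow_of_exponent_le one_le_two (by linarith : 1 + s ≤ 2)).trans_eq (by norm_num)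
  calc |u (x + x * w) - u 0| ≤ A * m x * (1 + |x + x * w| / x) ^ (1 + s) := h.growth x hx _
    _ ≤ A * m x * (2 * (1 + |w|)) ^ (1 + s) := by gcongr
    _ = A * m x * (2 ^ (1 + s) * (1 + |w|) ^ (1 + s)) := by
        rw [mul_rpow zero_le_two (by positivity)]
    _ ≤ A * m x * (4 * (1 + |w|) ^ (1 + s)) := by gcongr
    _ = _ := by ring

theorem abs_rescaled_sub_le (h : DyadicProfile s a A c m u) (hx : x ∈ Ioc 0 a) (hxy : x < y)
    (hy2 : y ≤ 2 * x) (hya : y ≤ a) {v w : ℝ} (hv : v ∈ Icc (-1 / 4) ((y - x) / x + 1 / 4))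
    (hw : w ∈ Icc (-1 / 4) ((y - x) / x + 1 / 4)) :
    |(u (x + x * v) - u 0) - (u (x + x * w) - u 0)| ≤ A * m x * |v - w| := by
  wlog hwv : w ≤ v generalizing v w
  · rw [abs_sub_comm, abs_sub_comm v]
    exact this hw hv (le_of_not_ge hwv)
  have hx0 := hx.1
  have hlow : 3 / 4 * x ≤ x + x * w := by nlinarith [hw.1]
  have hle : x + x * w ≤ x + x * v := by gcongr
  have hupp : x + x * v ≤ y + x / 4 := by
    have := mul_le_mul_of_nonneg_left hv.2 hx0.le
    rw [mul_add, mul_div_cancel₀ _ hx0.ne'] at this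
    linarith
  have hmono : u (x + x * w) ≤ u (x + x * v) :=
    h.mono ⟨by linarith, by linarith⟩ ⟨by linarith, by linarith⟩ hle
  rw [sub_sub_sub_cancel_right, abs_of_nonneg (sub_nonneg.2 hmono),
    abs_of_nonneg (sub_nonneg.2 hwv)]
  refine (h.lipschitz x hx _ _ hlow hle (by linarith) (by linarith)).trans_eq ?_
  field_simp
  ring

theorem exists_rpow_mul_abs_fracIntegral_sub_le (h : DyadicProfile s a A c m u) (hs : 0 < s)
    (hs1 : 2 * s < 1) (hp : 2 * s < p) (hu : IsBoundedHolder p u) :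
    ∃ K, 0 ≤ K ∧ ∀ x y, 0 < x → x < y → y ≤ 2 * x → y ≤ a →
      x ^ (2 * s) * |fracIntegral s u x - fracIntegral s u y| ≤
        K * (m x * ((y - x) / x) ^ (1 - 2 * s)) := by
  obtain ⟨K, hK, hunit⟩ := exists_abs_fracIntegral_sub_le hs hs1 hp
  have hA := h.A_pos
  refine ⟨K * (4 * A), by positivity, fun x y hx hxy hy2 hya => ?_⟩
  have hxa : x ∈ Ioc 0 a := ⟨hx, hxy.le.trans hya⟩
  have hm := h.pos x hxa
  have hU := hunit (A := 4 * A * m x) (hu.comp_affine_sub_const x x (u 0))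
    (div_pos (sub_pos.2 hxy) hx) ((div_le_one hx).2 (by linarith)) (by positivity)
    (h.abs_rescaled_le hs (by linarith) hxa) fun v hv w hw =>
      (h.abs_rescaled_sub_le hxa hxy hy2 hya hv hw).trans (by gcongr; linarith)
  rw [fracIntegral_sub_const, fracIntegral_sub_const, fracIntegral_comp_affine s u hx.ne',
    fracIntegral_comp_affine s u hx.ne', abs_of_pos hx, mul_zero, add_zero,
    mul_div_cancel₀ _ hx.ne', add_sub_cancel, ← mul_sub, abs_mul, abs_of_pos (by positivity)] at hU
  exact hU.trans_eq (by ring)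

theorem mul_rpow_le (h : DyadicProfile s a A c m u) (hβ : 0 ≤ β) (hβs : β ≤ 1 - 2 * s)
    (hm : ∀ x ∈ Ioc 0 a, m x ^ (1 - β) ≤ x ^ (2 * s)) (hx : 0 < x) (hxy : x < y)
    (hy2 : y ≤ 2 * x) (hya : y ≤ a) :
    m x * ((y - x) / x) ^ (1 - 2 * s) ≤ x ^ (2 * s) * (c⁻¹ ^ β * |u x - u y| ^ β) := by
  have hxa : x ∈ Ioc 0 a := ⟨hx, hxy.le.trans hya⟩
  have hmx := h.pos x hxa
  have hc := h.c_pos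
  have hr : 0 < (y - x) / x := div_pos (sub_pos.2 hxy) hx
  have hr1 : (y - x) / x ≤ 1 := (div_le_one hx).2 (by linarith)
  have hlower : m x * ((y - x) / x) ≤ c⁻¹ * |u x - u y| := by
    rw [le_inv_mul_iff₀ hc, ← mul_assoc, abs_sub_comm]
    exact (h.lower x y hx hxy.le hy2 hya).trans (le_abs_self _)
  calc m x * ((y - x) / x) ^ (1 - 2 * s) ≤ m x * ((y - x) / x) ^ β := by
        gcongr ?_ * ?_
        exact rpow_le_rpow_of_exponent_ge hr hr1 hβs
    _ = m x ^ (1 - β) * (m x * ((y - x) / x)) ^ β := by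
        rw [mul_rpow hmx.le hr.le, ← mul_assoc, ← rpow_add hmx, sub_add_cancel, rpow_one]
    _ ≤ x ^ (2 * s) * (c⁻¹ * |u x - u y|) ^ β := by
        gcongr
        exact hm x hxa
    _ = _ := by rw [mul_rpow (by positivity) (abs_nonneg _)]

theorem sub_half_le (h : DyadicProfile s a A c m u) (hs : s ≤ 1) (hx : x ∈ Ioc 0 a) :
    u (x / 2) - u 0 ≤ (1 + c / (4 * A))⁻¹ * (u x - u 0) := by
  obtain ⟨hx0, hxa⟩ := hx
  have hA := h.A_pos
  have hc := h.c_pos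
  have hx2 : x / 2 ∈ Ioc 0 a := ⟨by linarith, by linarith⟩
  have hm := h.pos _ hx2
  have hlower := h.lower (x / 2) x hx2.1 (by linarith) (by linarith) hxa
  rw [sub_half, div_self hx2.1.ne', mul_one] at hlower
  have hupper : u (x / 2) - u 0 ≤ 4 * A * m (x / 2) := by
    refine (le_abs_self _).trans ((h.growth _ hx2 (x / 2)).trans ?_)
    rw [abs_of_pos hx2.1, div_self hx2.1.ne', one_add_one_eq_two]
    have : (2 : ℝ) ^ (1 + s) ≤ 4 :=
      (rpow_le_rpow_of_exponent_le one_le_two (by linarith : 1 + s ≤ 2)).trans_eq (by norm_num)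
    nlinarith [mul_pos hA hm]
  have hgain : c / (4 * A) * (u (x / 2) - u 0) ≤ c * m (x / 2) := by
    rw [div_mul_eq_mul_div, div_le_iff₀ (by positivity)]
    nlinarith
  rw [le_inv_mul_iff₀ (by positivity), add_mul, one_mul]
  linarith

theorem holderControlledOn_fracIntegral (h : DyadicProfile s a A c m u) (hs : 0 < s)
    (hs1 : 2 * s < 1) (hp : 2 * s < p) (hβ : 0 < β) (hβs : β ≤ 1 - 2 * s)
    (hu : IsBoundedHolder p u) (hm : ∀ x ∈ Ioc 0 a, m x ^ (1 - β) ≤ x ^ (2 * s)) :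
    HolderControlledOn β u (fracIntegral s u) (Icc 0 a) := by
  obtain ⟨K, hK, hloc⟩ := h.exists_rpow_mul_abs_fracIntegral_sub_le hs hs1 hp hu
  have hc := h.c_pos
  have hgap : 0 < c / (4 * A) := div_pos hc (mul_pos four_pos h.A_pos)
  refine holderControlledOn_Icc_of_dyadic (K := K * c⁻¹ ^ β) hβ (by positivity)
    (inv_lt_one_of_one_lt₀ (lt_add_of_pos_right 1 hgap)) (by positivity)
    (hu.continuous_fracIntegral hs hp).continuousAt
    (h.mono.mono fun x hx => ⟨hx.1, by linarith [hx.1, hx.2]⟩)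
    (fun x hx => h.sub_half_le (by linarith) hx) fun x y hx hxy hy2 hya => ?_
  refine le_of_mul_le_mul_left ((hloc x y hx hxy hy2 hya).trans ?_) (rpow_pos_of_pos hx (2 * s))
  calc _ ≤ K * (x ^ (2 * s) * (c⁻¹ ^ β * |u x - u y| ^ β)) :=
        mul_le_mul_of_nonneg_left (h.mul_rpow_le hβ.le hβs hm hx hxy hy2 hya) hK
    _ = _ := by ring

end DyadicProfile

/-! ### Membership in Hölder classes and growth at a minimum -/

theorem isBoundedHolder_of_abs_sub_le {p B C : ℝ} {g : ℝ → ℝ} (hB : ∀ x y, |g x - g y| ≤ B)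
    (hC : ∀ x y, |g x - g y| ≤ C * |x - y| ^ p) : IsBoundedHolder p g := by
  have hB0 : 0 ≤ B := (abs_nonneg _).trans (hB 0 0)
  refine ⟨max B C, hB0.trans (le_max_left _ _), fun x y => ?_⟩
  rw [mul_min_of_nonneg _ _ (hB0.trans (le_max_left _ _)), mul_one]
  exact le_min ((hC x y).trans (by gcongr; exact le_max_right _ _))
    ((hB x y).trans (le_max_left _ _))

theorem IsBoundedHolder.holderClass {γ : ℝ} {g : ℝ → ℝ} (hg : IsBoundedHolder γ g) (hγ : 0 < γ)
    (hγ1 : γ < 1) : HolderClass γ univ g := by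
  rw [HolderClass, Nat.floor_eq_zero.2 hγ1]
  refine ⟨contDiffOn_zero.2 (hg.continuous hγ).continuousOn, fun k hk => ?_, ?_⟩
  · obtain ⟨M, hM⟩ := hg.exists_abs_le
    rw [Nat.le_zero.1 hk]
    exact ⟨M, fun x _ => hM x⟩
  · obtain ⟨C, hC, hg⟩ := hg
    refine ⟨C, fun x _ y _ => ?_⟩
    rw [Nat.cast_zero, sub_zero]
    exact (hg x y).trans (by gcongr; exact min_le_left _ _)

theorem exists_abs_le_of_periodic {g : ℝ → ℝ} {T : ℝ} (hg : Continuous g)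
    (hp : Function.Periodic g T) (hT : T ≠ 0) : ∃ M, ∀ x, |g x| ≤ M := by
  obtain ⟨M, hM⟩ := (hp.isBounded_of_continuous hT hg).exists_norm_le
  exact ⟨M, fun x => hM _ (mem_range_self x)⟩

theorem holderClass_one_of_periodic {g : ℝ → ℝ} {T : ℝ} (hg : ContDiff ℝ 1 g)
    (hp : Function.Periodic g T) (hT : T ≠ 0) : HolderClass 1 univ g := by
  have hp' : Function.Periodic (deriv g) T := fun x => by
    rw [← deriv_comp_add_const, funext hp]
  obtain ⟨B, hB⟩ := exists_abs_le_of_periodic hg.continuous hp hT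
  obtain ⟨M, hM⟩ := exists_abs_le_of_periodic hg.continuous_deriv_one hp' hT
  rw [HolderClass, Nat.floor_one]
  refine ⟨hg.contDiffOn, fun k hk => ?_, M + M, fun x _ y _ => ?_⟩
  · interval_cases k
    · exact ⟨B, fun x _ => hB x⟩
    · rw [iteratedDerivWithin_univ, iteratedDeriv_one]
      exact ⟨M, fun x _ => hM x⟩
  · rw [iteratedDerivWithin_univ, iteratedDeriv_one, Nat.cast_one, sub_self, rpow_zero, mul_one]
    exact (abs_sub _ _).trans (add_le_add (hM x) (hM y))

theorem HolderControlledOn.exists_holderClass_comp_eq {β a b : ℝ} {u H : ℝ → ℝ}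
    (h : HolderControlledOn β u H univ) (hβ : 0 < β) (hβ1 : β < 1) (hu : range u = Icc a b) :
    ∃ f, HolderClass β univ f ∧ ∀ x, f (u x) = H x := by
  obtain ⟨K, hK, h⟩ := h
  have hab : a ≤ b := nonempty_Icc.1 (hu ▸ range_nonempty u)
  have hproj (t : ℝ) : ∃ x, u x = projIcc a b hab t :=
    mem_range.1 (hu.symm ▸ (projIcc a b hab t).2)
  choose g hg using hproj
  have hHg (t v : ℝ) :
      |H (g t) - H (g v)| ≤ K * |(projIcc a b hab t - projIcc a b hab v : ℝ)| ^ β := by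
    rw [← hg, ← hg]
    exact h _ (mem_univ _) _ (mem_univ _)
  have hf : IsBoundedHolder β fun t => H (g t) :=
    isBoundedHolder_of_abs_sub_le (B := K * (b - a) ^ β) (C := K)
      (fun t v => (hHg t v).trans (by
        gcongr
        exact Real.dist_le_of_mem_Icc (projIcc a b hab t).2 (projIcc a b hab v).2))
      (fun t v => (hHg t v).trans (by gcongr ?_ * ?_ ^ _; exact abs_projIcc_sub_projIcc hab))
  refine ⟨_, hf.holderClass hβ hβ1, fun x => ?_⟩
  have hx := h (g (u x)) (mem_univ _) x (mem_univ _)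
  rw [hg, projIcc_of_mem hab (hu ▸ mem_range_self x), sub_self, abs_zero, zero_rpow hβ.ne',
    mul_zero] at hx
  exact sub_eq_zero.1 (abs_nonpos_iff.1 hx)

namespace HolderClass

variable {γ a b x₀ : ℝ} {g : ℝ → ℝ}

theorem exists_abs_derivWithin_sub_le (hg : HolderClass γ (Icc a b) g) (hab : a < b)
    (hγ : 1 ≤ γ) : ∃ K, 0 ≤ K ∧ ∀ x ∈ Icc a b, ∀ y ∈ Icc a b,
      |derivWithin g (Icc a b) x - derivWithin g (Icc a b) y| ≤ K * |x - y| ^ (min γ 2 - 1) := by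
  obtain ⟨hcd, hbd, C, hC⟩ := hg
  simp only [← iteratedDerivWithin_one]
  rcases lt_or_ge γ 2 with hγ2 | hγ2
  · have hfloor : ⌊γ⌋₊ = 1 := (Nat.floor_eq_iff (by linarith)).2 (by norm_num [hγ, hγ2])
    rw [hfloor, Nat.cast_one] at hC
    rw [min_eq_left hγ2.le]
    exact ⟨|C|, abs_nonneg C, fun x hx y hy =>
      (hC x hx y hy).trans (by gcongr; exact le_abs_self C)⟩
  · have hfloor : 2 ≤ ⌊γ⌋₊ := Nat.le_floor hγ2
    obtain ⟨M, hM⟩ := hbd 2 hfloor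
    have hM0 : 0 ≤ M := (abs_nonneg _).trans (hM a ⟨le_rfl, hab.le⟩)
    have hdiff : DifferentiableOn ℝ (iteratedDerivWithin 1 g (Icc a b)) (Icc a b) :=
      hcd.differentiableOn_iteratedDerivWithin (by exact_mod_cast hfloor) (uniqueDiffOn_Icc hab)
    rw [min_eq_right hγ2]
    refine ⟨M, hM0, fun x hx y hy => ?_⟩
    norm_num only [rpow_one]
    refine (convex_Icc a b).norm_image_sub_le_of_norm_derivWithin_le hdiff (fun z hz => ?_) hy hx
    rw [← iteratedDerivWithin_succ]
    exact hM z hz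

theorem isBigO_sub_of_isLocalMin (hg : HolderClass γ (Icc a b) g) (hx₀ : x₀ ∈ Ioo a b)
    (hmin : IsLocalMin g x₀) :
    (fun x => g x - g x₀) =O[𝓝 x₀] fun x => |x - x₀| ^ min γ 2 := by
  have hab := hx₀.1.trans hx₀.2
  have hnhds : Icc a b ∈ 𝓝 x₀ := Icc_mem_nhds hx₀.1 hx₀.2
  have hx₀' := mem_of_mem_nhds hnhds
  suffices ∃ K, ∀ x ∈ Icc a b, |g x - g x₀| ≤ K * |x - x₀| ^ min γ 2 by
    obtain ⟨K, hK⟩ := this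
    refine .of_bound K (eventually_of_mem hnhds fun x hx => (hK x hx).trans_eq ?_)
    rw [norm_of_nonneg (by positivity)]
  rcases lt_or_ge γ 1 with hγ | hγ
  · obtain ⟨-, -, C, hC⟩ := hg
    rw [Nat.floor_eq_zero.2 hγ, Nat.cast_zero, sub_zero] at hC
    rw [min_eq_left (by linarith)]
    exact ⟨C, fun x hx => hC x hx x₀ hx₀'⟩
  · obtain ⟨K, hK, hderiv⟩ := hg.exists_abs_derivWithin_sub_le hab hγ
    have hzero : derivWithin g (Icc a b) x₀ = 0 := by
      rw [derivWithin_of_mem_nhds hnhds, hmin.deriv_eq_zero]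
    have hdiff : DifferentiableOn ℝ g (Icc a b) :=
      hg.1.differentiableOn (by exact_mod_cast (Nat.floor_pos.2 hγ).ne')
    refine ⟨K, fun x hx => ?_⟩
    rcases eq_or_ne x x₀ with rfl | hne
    · rw [sub_self, abs_zero]
      positivity
    have hseg : uIcc x₀ x ⊆ Icc a b := uIcc_subset_Icc hx₀' hx
    have hmean := (convex_uIcc x₀ x).norm_image_sub_le_of_norm_hasDerivWithin_le
      (C := K * |x - x₀| ^ (min γ 2 - 1))
      (fun y hy => (hdiff y (hseg hy)).hasDerivWithinAt.mono hseg) (fun y hy => ?_)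
      left_mem_uIcc right_mem_uIcc
    · rwa [norm_eq_abs, norm_eq_abs, mul_assoc, ← rpow_add_one (abs_pos.2 (sub_ne_zero.2 hne)).ne',
        sub_add_cancel] at hmean
    · have hy' := hderiv y (hseg hy) x₀ hx₀'
      rw [hzero, sub_zero] at hy'
      have hexp : 0 ≤ min γ 2 - 1 := sub_nonneg.2 (le_min hγ one_le_two)
      exact hy'.trans (by gcongr K * ?_ ^ _; exact abs_sub_left_of_mem_uIcc hy)

end HolderClass

/-! ### Powers with a logarithmic loss -/

/-- The even function `|t|^α / (1 - log |t|)` on `[-1, 1]` (`Real.log` is even). It is of class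
`C^α` with a strict minimum at `0`, but the logarithm beats every larger Hölder exponent there and,
for `α = 1`, makes the function continuously differentiable. -/
noncomputable def logPower (α t : ℝ) : ℝ := |t| ^ α / (1 - log t)

section LogPower

variable {α s γ p q t x : ℝ}

theorem logPower_neg (α t : ℝ) : logPower α (-t) = logPower α t := by
  rw [logPower, abs_neg, log_neg_eq_log, logPower]

theorem logPower_abs (α t : ℝ) : logPower α |t| = logPower α t := by
  rw [logPower, abs_abs, log_abs, logPower]

theorem logPower_of_pos (α : ℝ) (ht : 0 < t) : logPower α t = t ^ α / (1 - log t) := by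
  rw [logPower, abs_of_pos ht]

theorem logPower_zero (hα : 0 < α) : logPower α 0 = 0 := by
  rw [logPower, abs_zero, zero_rpow hα.ne', zero_div]

theorem logPower_one (α : ℝ) : logPower α 1 = 1 := by
  rw [logPower, abs_one, one_rpow, log_one, sub_zero, div_one]

theorem one_le_one_sub_log (ht : |t| ≤ 1) : 1 ≤ 1 - log t := by
  rw [← log_abs]
  linarith [log_nonpos (abs_nonneg t) ht]

theorem logPower_nonneg (ht : |t| ≤ 1) : 0 ≤ logPower α t :=
  div_nonneg (by positivity) (zero_le_one.trans (one_le_one_sub_log ht))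

theorem logPower_pos (ht : 0 < t) (ht1 : t ≤ 1) : 0 < logPower α t := by
  rw [logPower_of_pos α ht]
  exact div_pos (by positivity)
    (one_pos.trans_le (one_le_one_sub_log (abs_le.2 ⟨by linarith, ht1⟩)))

theorem logPower_le_rpow (ht : |t| ≤ 1) : logPower α t ≤ |t| ^ α :=
  div_le_self (by positivity) (one_le_one_sub_log ht)

theorem logPower_le_one (hα : 0 < α) (ht : |t| ≤ 1) : logPower α t ≤ 1 :=
  (logPower_le_rpow ht).trans (rpow_le_one (abs_nonneg t) ht hα.le)

theorem logPower_le_mul (α : ℝ) (hp : 0 < p) (hpq : p ≤ q) (hq : q ≤ 1) :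
    logPower α q ≤ (q / p) ^ α * (1 + log (q / p)) * logPower α p := by
  have hq0 : 0 < q := hp.trans_le hpq
  have hLq : 1 ≤ 1 - log q := one_le_one_sub_log (abs_le.2 ⟨by linarith, hq⟩)
  have hLp : 0 < 1 - log p := by linarith [log_le_log hp hpq]
  have hlog : 1 - log p ≤ (1 + log (q / p)) * (1 - log q) := by
    rw [log_div hq0.ne' hp.ne']
    nlinarith [log_le_log hp hpq]
  rw [logPower_of_pos α hq0, logPower_of_pos α hp, mul_right_comm, div_rpow hq0.le hp.le,
    div_mul_div_cancel₀ (by positivity), div_mul_eq_mul_div, div_le_div_iff₀ (by linarith) hLp,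
    mul_assoc]
  gcongr

theorem logPower_le_sq_mul (hα1 : α ≤ 1) (hp : 0 < p) (hpq : p ≤ q) (hq : q ≤ 1) :
    logPower α q ≤ (q / p) ^ 2 * logPower α p := by
  have hr : 1 ≤ q / p := (one_le_div hp).2 hpq
  have hrα : (q / p) ^ α ≤ q / p := (rpow_le_rpow_of_exponent_le hr hα1).trans_eq (rpow_one _)
  have hlog : 1 + log (q / p) ≤ q / p := by linarith [log_le_sub_one_of_pos (one_pos.trans_le hr)]
  have hlog0 : 0 ≤ log (q / p) := log_nonneg hr
  have hφ := (logPower_pos (α := α) hp (hpq.trans hq)).le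
  refine (logPower_le_mul α hp hpq hq).trans ?_
  rw [sq]
  gcongr

theorem sq_le_logPower (hα : 0 < α) (hα1 : α ≤ 1) (ht : |t| ≤ 1) : t ^ 2 ≤ logPower α t := by
  rcases eq_or_ne t 0 with rfl | ht0
  · rw [logPower_zero hα, zero_pow two_ne_zero]
  · have h := logPower_le_sq_mul hα1 (abs_pos.2 ht0) ht le_rfl
    rwa [logPower_one, logPower_abs, div_pow, one_pow, sq_abs, one_div_mul_eq_div,
      one_le_div (by positivity)] at h

theorem logPower_sub_le (hα : 0 < α) (hα1 : α ≤ 1) (hp : 0 ≤ p) (hpq : p ≤ q) (hq : q ≤ 1) :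
    logPower α q - logPower α p ≤ 2 * logPower α q * ((q - p) / q) := by
  rcases hpq.eq_or_lt with rfl | hpq'
  · rw [sub_self, sub_self, zero_div, mul_zero]
  have hq0 : 0 < q := hp.trans_lt hpq'
  have hφ := (logPower_pos (α := α) hq0 hq).le
  rw [sub_div, div_self hq0.ne']
  rcases hp.eq_or_lt with rfl | hp0
  · rw [logPower_zero hα, zero_div]
    linarith
  have hsq : (p / q) ^ 2 * logPower α q ≤ logPower α p := by
    have h := logPower_le_sq_mul hα1 hp0 hpq hq
    rwa [← div_le_iff₀' (by positivity), div_eq_inv_mul, ← inv_pow, inv_div] at h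
  -- `1 - r ^ 2 ≤ 2 * (1 - r)`
  nlinarith [mul_nonneg (sq_nonneg (1 - p / q)) hφ]

theorem le_logPower_sub (hα : 0 < α) (hα1 : α ≤ 1) (hp : 0 < p) (hpq : p ≤ q) (hq : q ≤ 1) :
    α * logPower α q * ((q - p) / q) ≤ logPower α q - logPower α p := by
  have hq0 : 0 < q := hp.trans_le hpq
  have hLq : 1 ≤ 1 - log q := one_le_one_sub_log (abs_le.2 ⟨by linarith, hq⟩)
  have hlog := log_le_log hp hpq
  have hbernoulli : (p / q) ^ α ≤ 1 - α * ((q - p) / q) := by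
    have h := rpow_one_add_le_one_add_mul_self (s := p / q - 1) (by linarith [div_pos hp hq0])
      hα.le hα1
    rw [add_sub_cancel] at h
    rw [sub_div, div_self hq0.ne']
    linarith
  have hratio : logPower α p ≤ (p / q) ^ α * logPower α q := by
    rw [logPower_of_pos α hp, logPower_of_pos α hq0, div_rpow hp.le hq0.le,
      div_mul_div_cancel₀ (by positivity)]
    gcongr
  nlinarith [logPower_pos (α := α) hq0 hq]

theorem monotoneOn_logPower (hα : 0 < α) (hα1 : α ≤ 1) :
    MonotoneOn (logPower α) (Icc 0 1) := by
  intro p hp q hq hpq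
  rcases hp.1.eq_or_lt with rfl | hp0
  · rw [logPower_zero hα]
    exact logPower_nonneg (abs_le.2 ⟨by linarith [hq.1], hq.2⟩)
  · refine sub_nonneg.1 (le_trans ?_ (le_logPower_sub hα hα1 hp0 hpq hq.2))
    have hq0 := hp0.trans_le hpq
    have := logPower_pos (α := α) hq0 hq.2
    have := sub_nonneg.2 hpq
    positivity

theorem logPower_le_sq_mul_of_le_mul {k : ℝ} (hα : 0 < α) (hα1 : α ≤ 1) (hp : p ∈ Ioc 0 1)
    (hq : q ∈ Icc 0 1) (hk : 1 ≤ k) (hqp : q ≤ k * p) :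
    logPower α q ≤ k ^ 2 * logPower α p := by
  have hφ := logPower_pos (α := α) hp.1 hp.2
  rcases le_total p q with hpq | hqp'
  · refine (logPower_le_sq_mul hα1 hp.1 hpq hq.2).trans ?_
    have := div_nonneg hq.1 hp.1.le
    gcongr
    rwa [div_le_iff₀ hp.1]
  · exact (monotoneOn_logPower hα hα1 hq ⟨hp.1.le, hp.2⟩ hqp').trans
      (le_mul_of_one_le_left hφ.le (one_le_pow₀ hk))

theorem logPower_le_growth (hα : 0 < α) (hα1 : α ≤ 1) (hs : 0 < s) (hx : 0 < x) (hx1 : x ≤ 1)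
    (ht : |t| ≤ 1) : logPower α t ≤ (1 + 1 / s) * logPower α x * (1 + |t| / x) ^ (1 + s) := by
  have hφ := logPower_pos (α := α) hx hx1
  rw [← logPower_abs]
  rcases le_total |t| x with htx | hxt
  · have hs' : 1 ≤ 1 + 1 / s := le_add_of_nonneg_right (by positivity)
    have hone : 1 ≤ (1 + |t| / x) ^ (1 + s) :=
      one_le_rpow (le_add_of_nonneg_right (by positivity)) (by linarith)
    calc logPower α |t| ≤ logPower α x :=
          monotoneOn_logPower hα hα1 ⟨abs_nonneg t, ht⟩ ⟨hx.le, hx1⟩ htx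
      _ = 1 * logPower α x * 1 := by ring
      _ ≤ _ := by gcongr
  · have hr : 1 ≤ |t| / x := (one_le_div hx).2 hxt
    have hrα : (|t| / x) ^ α ≤ |t| / x :=
      (rpow_le_rpow_of_exponent_le hr hα1).trans_eq (rpow_one _)
    have hlog : 1 + log (|t| / x) ≤ (1 + 1 / s) * (|t| / x) ^ s := by
      have := log_le_rpow_div (zero_le_one.trans hr) hs
      have := one_le_rpow hr hs.le
      rw [add_mul, one_mul, one_div_mul_eq_div]
      linarith
    have hlog0 : 0 ≤ log (|t| / x) := log_nonneg hr
    calc logPower α |t| ≤ (|t| / x) ^ α * (1 + log (|t| / x)) * logPower α x :=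
          logPower_le_mul α hx hxt ht
      _ ≤ |t| / x * ((1 + 1 / s) * (|t| / x) ^ s) * logPower α x := by gcongr
      _ = (1 + 1 / s) * logPower α x * (|t| / x) ^ (1 + s) := by
          rw [rpow_one_add' (by positivity) (by linarith)]
          ring
      _ ≤ _ := by
          gcongr
          linarith

theorem abs_logPower_sub_le (hα : 0 < α) (hα1 : α ≤ 1) (hp : |p| ≤ 1) (hq : |q| ≤ 1) :
    |logPower α p - logPower α q| ≤ 2 * |p - q| ^ α := by
  suffices key : ∀ {p q : ℝ}, 0 ≤ p → p ≤ q → q ≤ 1 →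
      |logPower α p - logPower α q| ≤ 2 * |p - q| ^ α by
    rw [← logPower_abs α p, ← logPower_abs α q]
    have habs : 2 * |(|p| - |q|)| ^ α ≤ 2 * |p - q| ^ α := by
      gcongr 2 * ?_ ^ _
      exact abs_abs_sub_abs_le p q
    refine le_trans ?_ habs
    rcases le_total |p| |q| with hpq | hqp
    · exact key (abs_nonneg p) hpq hq
    · rw [abs_sub_comm, abs_sub_comm |p|]
      exact key (abs_nonneg q) hqp hp
  intro p q hp hpq hq
  rw [abs_sub_comm, abs_sub_comm p, abs_of_nonneg (sub_nonneg.2 (monotoneOn_logPower hα hα1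
    ⟨hp, hpq.trans hq⟩ ⟨hp.trans hpq, hq⟩ hpq)), abs_of_nonneg (sub_nonneg.2 hpq)]
  rcases hpq.eq_or_lt with rfl | hpq'
  · rw [sub_self, sub_self]
    positivity
  have hq0 : 0 < q := hp.trans_lt hpq'
  have hr : 0 < (q - p) / q := div_pos (sub_pos.2 hpq') hq0
  have hrα : (q - p) / q ≤ ((q - p) / q) ^ α := by
    simpa only [rpow_one] using
      rpow_le_rpow_of_exponent_ge hr ((div_le_one hq0).2 (sub_le_self q hp)) hα1
  have hφ : logPower α q ≤ q ^ α := by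
    simpa only [abs_of_pos hq0] using logPower_le_rpow (abs_le.2 ⟨by linarith, hq⟩)
  calc logPower α q - logPower α p ≤ 2 * logPower α q * ((q - p) / q) :=
        logPower_sub_le hα hα1 hp hpq hq
    _ ≤ 2 * q ^ α * ((q - p) / q) ^ α := by gcongr
    _ = 2 * (q - p) ^ α := by
        rw [mul_assoc, ← mul_rpow hq0.le hr.le, mul_div_cancel₀ _ hq0.ne']

theorem rpow_isLittleO_logPower (hαγ : α < γ) :
    (fun x => x ^ γ) =o[𝓝[>] 0] logPower α := by
  have hlim : Tendsto (fun x : ℝ => x ^ (γ - α) - log x * x ^ (γ - α)) (𝓝[>] 0) (𝓝 0) := by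
    have hpow : Tendsto (fun x : ℝ => x ^ (γ - α)) (𝓝[>] 0) (𝓝 0) := by
      have := (continuousAt_rpow_const 0 (γ - α) (.inr (sub_pos.2 hαγ).le)).tendsto
      rw [zero_rpow (sub_pos.2 hαγ).ne'] at this
      exact this.mono_left nhdsWithin_le_nhds
    simpa only [sub_zero] using hpow.sub (tendsto_log_mul_rpow_nhdsGT_zero (sub_pos.2 hαγ))
  have hev : ∀ᶠ x : ℝ in 𝓝[>] 0, x ∈ Ioc 0 1 := Ioc_mem_nhdsGT one_pos
  refine (Asymptotics.isLittleO_iff_tendsto' (hev.mono fun x hx h =>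
    absurd h (logPower_pos hx.1 hx.2).ne')).2 (hlim.congr' (hev.mono fun x hx => ?_))
  dsimp only
  rw [logPower_of_pos α hx.1, rpow_sub hx.1, div_div_eq_mul_div]
  ring

end LogPower

/-! ### The periodic profile -/

theorem half_le_sin {x : ℝ} (hx : 0 ≤ x) (hx1 : x ≤ π / 2) : x / 2 ≤ sin x := by
  refine le_trans ?_ (mul_le_sin hx hx1)
  have hpi : 1 / 2 ≤ 2 / π := by
    rw [div_le_div_iff₀ two_pos pi_pos]
    linarith [pi_le_four]
  nlinarith

theorem half_le_cos {x : ℝ} (hx : 0 ≤ x) (hx1 : x ≤ π / 3) : 1 / 2 ≤ cos x := by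
  rw [← cos_pi_div_three]
  exact cos_le_cos_of_nonneg_of_le_pi hx (by linarith [pi_pos]) hx1

theorem cos_sub_cos_le {w v : ℝ} (hw : 0 ≤ w) (hwv : w ≤ v) (hv : v ≤ π) :
    cos w - cos v ≤ v * (v - w) := by
  have hsum : sin ((w + v) / 2) ≤ v := (sin_le (by linarith)).trans (by linarith)
  have hdiff : sin ((v - w) / 2) ≤ (v - w) / 2 := sin_le (by linarith)
  have hdiff0 : 0 ≤ sin ((v - w) / 2) := sin_nonneg_of_nonneg_of_le_pi (by linarith) (by linarith)
  have hprod := mul_le_mul hsum hdiff hdiff0 (hw.trans hwv)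
  rw [cos_sub_cos, ← neg_sub v w, neg_div, sin_neg]
  linarith

theorem le_sin_sub_sin {x y : ℝ} (hx : 0 ≤ x) (hxy : x ≤ y) (hy : y ≤ π / 4) :
    (y - x) / 4 ≤ sin y - sin x := by
  have hpi := pi_pos
  have hsin := half_le_sin (by linarith : 0 ≤ (y - x) / 2) (by linarith)
  have hcos := half_le_cos (by linarith : 0 ≤ (y + x) / 2) (by linarith)
  rw [sin_sub_sin]
  nlinarith

/-- The `π`-periodic function with a minimum at `0` and a maximum at `π / 2`, both of the shape of
`logPower α`. -/
noncomputable def periodicProfile (α x : ℝ) : ℝ := logPower α (sin x) - logPower α (cos x)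

section PeriodicProfile

variable {α s x y v w : ℝ}

theorem periodicProfile_neg (α x : ℝ) : periodicProfile α (-x) = periodicProfile α x := by
  simp only [periodicProfile, sin_neg, cos_neg, logPower_neg]

theorem periodicProfile_pi_div_two_sub (α x : ℝ) :
    periodicProfile α (π / 2 - x) = -periodicProfile α x := by
  simp only [periodicProfile, sin_pi_div_two_sub, cos_pi_div_two_sub, neg_sub]

theorem periodic_periodicProfile (α : ℝ) : Function.Periodic (periodicProfile α) π := fun x => by
  simp only [periodicProfile, sin_add_pi, cos_add_pi, logPower_neg]

theorem periodicProfile_zero (hα : 0 < α) : periodicProfile α 0 = -1 := by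
  rw [periodicProfile, sin_zero, cos_zero, logPower_zero hα, logPower_one, zero_sub]

theorem abs_periodicProfile_le_one (hα : 0 < α) (x : ℝ) : |periodicProfile α x| ≤ 1 := by
  have hsin := abs_sin_le_one x
  have hcos := abs_cos_le_one x
  rw [periodicProfile, abs_le]
  constructor <;> linarith [logPower_nonneg (α := α) hsin, logPower_nonneg (α := α) hcos,
    logPower_le_one hα hsin, logPower_le_one hα hcos]

theorem isBoundedHolder_periodicProfile (hα : 0 < α) (hα1 : α ≤ 1) :
    IsBoundedHolder α (periodicProfile α) := by
  refine isBoundedHolder_of_abs_sub_le (B := 2) (C := 4) (fun x y => ?_) fun x y => ?_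
  · exact (abs_sub _ _).trans
      (by linarith [abs_periodicProfile_le_one hα x, abs_periodicProfile_le_one hα y])
  · have hsin : |logPower α (sin x) - logPower α (sin y)| ≤ 2 * |x - y| ^ α :=
      (abs_logPower_sub_le hα hα1 (abs_sin_le_one x) (abs_sin_le_one y)).trans
        (by gcongr 2 * ?_ ^ _; exact abs_sin_sub_sin_le x y)
    have hcos : |logPower α (cos x) - logPower α (cos y)| ≤ 2 * |x - y| ^ α :=
      (abs_logPower_sub_le hα hα1 (abs_cos_le_one x) (abs_cos_le_one y)).trans
        (by gcongr 2 * ?_ ^ _; exact abs_cos_sub_cos_le x y)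
    rw [periodicProfile, periodicProfile, sub_sub_sub_comm]
    exact (abs_sub _ _).trans (by linarith)

theorem range_periodicProfile (hα : 0 < α) (hα1 : α ≤ 1) :
    range (periodicProfile α) = Icc (-1) 1 := by
  refine subset_antisymm (range_subset_iff.2 fun x => abs_le.1 (abs_periodicProfile_le_one hα x)) ?_
  have hivt := intermediate_value_Icc (by positivity : 0 ≤ π / 2)
    ((isBoundedHolder_periodicProfile hα hα1).continuous hα).continuousOn
  have htop : periodicProfile α (π / 2) = 1 := by
    rw [← sub_zero (π / 2), periodicProfile_pi_div_two_sub, periodicProfile_zero hα, neg_neg]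
  rw [periodicProfile_zero hα, htop] at hivt
  exact hivt.trans (image_subset_range _ _)

theorem logPower_sin_le_periodicProfile_sub (hα : 0 < α) (x : ℝ) :
    logPower α (sin x) ≤ periodicProfile α x - periodicProfile α 0 := by
  rw [periodicProfile_zero hα, periodicProfile]
  linarith [logPower_le_one hα (abs_cos_le_one x)]

theorem periodicProfile_zero_le (hα : 0 < α) (x : ℝ) :
    periodicProfile α 0 ≤ periodicProfile α x :=
  sub_nonneg.1
    ((logPower_nonneg (abs_sin_le_one x)).trans (logPower_sin_le_periodicProfile_sub hα x))

theorem periodicProfile_sub_le (hα : 0 < α) (hα1 : α ≤ 1) (x : ℝ) :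
    periodicProfile α x - periodicProfile α 0 ≤ 2 * logPower α (sin x) := by
  rw [periodicProfile_zero hα, periodicProfile]
  linarith [sq_le_logPower hα hα1 (abs_cos_le_one x), sq_le_logPower hα hα1 (abs_sin_le_one x),
    sin_sq_add_cos_sq x]

theorem monotoneOn_logPower_sin (hα : 0 < α) (hα1 : α ≤ 1) :
    MonotoneOn (fun x => logPower α (sin x)) (Icc 0 (π / 2)) :=
  (monotoneOn_logPower hα hα1).comp
    (strictMonoOn_sin.monotoneOn.mono (Icc_subset_Icc_left (by linarith [pi_pos])))
    fun x hx => ⟨sin_nonneg_of_nonneg_of_le_pi hx.1 (by linarith [hx.2, pi_pos]), sin_le_one x⟩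

theorem antitoneOn_logPower_cos (hα : 0 < α) (hα1 : α ≤ 1) :
    AntitoneOn (fun x => logPower α (cos x)) (Icc 0 (π / 2)) :=
  (monotoneOn_logPower hα hα1).comp_AntitoneOn
    (strictAntiOn_cos.antitoneOn.mono (Icc_subset_Icc_right (by linarith [pi_pos])))
    fun x hx => ⟨cos_nonneg_of_mem_Icc ⟨by linarith [hx.1, pi_pos], hx.2⟩, cos_le_one x⟩

theorem monotoneOn_periodicProfile (hα : 0 < α) (hα1 : α ≤ 1) :
    MonotoneOn (periodicProfile α) (Icc 0 (π / 2)) := fun _ hx _ hy hxy =>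
  sub_le_sub (monotoneOn_logPower_sin hα hα1 hx hy hxy) (antitoneOn_logPower_cos hα hα1 hx hy hxy)

theorem logPower_sin_sub_le (hα : 0 < α) (hα1 : α ≤ 1) (hx : x ∈ Ioc 0 1) (hw : 3 / 4 * x ≤ w)
    (hwv : w ≤ v) (hv : v ≤ 9 / 4 * x) (hv1 : v ≤ π / 2) :
    logPower α (sin v) - logPower α (sin w) ≤ 27 * (logPower α x / x * (v - w)) := by
  have := pi_pos
  have hx0 := hx.1
  have hφ := logPower_pos (α := α) hx0 hx.2
  have hsinw : 0 ≤ sin w := sin_nonneg_of_nonneg_of_le_pi (by linarith) (by linarith)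
  have hsinwv : sin w ≤ sin v := sin_le_sin_of_le_of_le_pi_div_two (by linarith) hv1 hwv
  have hsinv : 3 / 8 * x ≤ sin v := by linarith [half_le_sin (by linarith : 0 ≤ v) hv1]
  have hdiff : sin v - sin w ≤ v - w := by
    simpa only [abs_of_nonneg (sub_nonneg.2 hsinwv), abs_of_nonneg (sub_nonneg.2 hwv)] using
      abs_sin_sub_sin_le v w
  have hsize : logPower α (sin v) ≤ (9 / 4) ^ 2 * logPower α x :=
    logPower_le_sq_mul_of_le_mul hα hα1 hx ⟨hsinw.trans hsinwv, sin_le_one v⟩ (by norm_num)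
      ((sin_le (by linarith)).trans hv)
  calc logPower α (sin v) - logPower α (sin w)
      ≤ 2 * logPower α (sin v) * ((sin v - sin w) / sin v) :=
        logPower_sub_le hα hα1 hsinw hsinwv (sin_le_one v)
    _ ≤ 2 * ((9 / 4) ^ 2 * logPower α x) * ((v - w) / (3 / 8 * x)) := by
        have := sub_nonneg.2 hwv
        have := div_nonneg (sub_nonneg.2 hsinwv) (by linarith : 0 ≤ sin v)
        gcongr
    _ = _ := by
        field_simp
        ring

theorem logPower_cos_sub_le (hα : 0 < α) (hα1 : α ≤ 1) (hx : x ∈ Ioc 0 1) (hw : 0 ≤ w)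
    (hwv : w ≤ v) (hv : v ≤ 9 / 4 * x) (hv1 : v ≤ π / 3) :
    logPower α (cos w) - logPower α (cos v) ≤ 9 * (logPower α x / x * (v - w)) := by
  have hpi := pi_pos
  have hx0 := hx.1
  have hcosw := half_le_cos hw (hwv.trans hv1)
  have hcosv := half_le_cos (hw.trans hwv) hv1
  have hcoswv : cos v ≤ cos w := cos_le_cos_of_nonneg_of_le_pi hw (by linarith) hwv
  have hdiff : cos w - cos v ≤ v * (v - w) := cos_sub_cos_le hw hwv (by linarith)
  have hxφ : x ≤ logPower α x / x := by
    rw [le_div_iff₀ hx0, ← sq]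
    exact sq_le_logPower hα hα1 (abs_le.2 ⟨by linarith, hx.2⟩)
  have := sub_nonneg.2 hwv
  have hv0 := hw.trans hwv
  calc logPower α (cos w) - logPower α (cos v)
      ≤ 2 * logPower α (cos w) * ((cos w - cos v) / cos w) :=
        logPower_sub_le hα hα1 (by linarith) hcoswv (cos_le_one w)
    _ ≤ 2 * 1 * (v * (v - w) / (1 / 2)) := by
        have := sub_nonneg.2 hcoswv
        gcongr
        exact logPower_le_one hα (abs_cos_le_one w)
    _ = 4 * (v * (v - w)) := by ring
    _ ≤ 4 * (9 / 4 * (logPower α x / x) * (v - w)) := by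
        gcongr
        linarith
    _ = _ := by ring

theorem le_periodicProfile_sub (hα : 0 < α) (hα1 : α ≤ 1) (hx : 0 < x) (hxy : x ≤ y)
    (hy : y ≤ π / 4) (hy2 : y ≤ 2 * x) :
    α / 32 * logPower α x * ((y - x) / x) ≤ periodicProfile α y - periodicProfile α x := by
  have := pi_pos
  have hx1 : x ≤ 1 := by linarith [pi_le_four]
  have hsinx := half_le_sin hx.le (by linarith)
  have hsiny := half_le_sin (hx.le.trans hxy) (by linarith)
  have hsinxy := le_sin_sub_sin hx.le hxy hy
  have hcos : logPower α (cos y) ≤ logPower α (cos x) :=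
    antitoneOn_logPower_cos hα hα1 ⟨hx.le, by linarith⟩ ⟨by linarith, by linarith⟩ hxy
  have hsize : logPower α x ≤ 2 ^ 2 * logPower α (sin y) :=
    logPower_le_sq_mul_of_le_mul hα hα1 ⟨by linarith, sin_le_one y⟩ ⟨hx.le, hx1⟩ one_le_two
      (by linarith)
  have hφ := logPower_pos (α := α) hx hx1
  calc α / 32 * logPower α x * ((y - x) / x)
      = α * (logPower α x / 4) * ((y - x) / 4 / (2 * x)) := by
        field_simp
        ring
    _ ≤ α * logPower α (sin y) * ((sin y - sin x) / sin y) := by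
        have := sub_nonneg.2 hxy
        have := logPower_nonneg (α := α) (abs_sin_le_one y)
        gcongr
        · linarith
        · linarith
        · linarith
        · exact (sin_le (by linarith)).trans hy2
    _ ≤ logPower α (sin y) - logPower α (sin x) :=
        le_logPower_sub hα hα1 (by linarith) (by linarith) (sin_le_one y)
    _ ≤ periodicProfile α y - periodicProfile α x := by
        rw [periodicProfile, periodicProfile]
        linarith

theorem abs_periodicProfile_sub_zero_le (hα : 0 < α) (hα1 : α ≤ 1) (hs : 0 < s)
    (hx : x ∈ Ioc 0 1) (w : ℝ) : |periodicProfile α w - periodicProfile α 0| ≤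
      2 * ((1 + 1 / s) * logPower α x * (1 + |w| / x) ^ (1 + s)) := by
  have hφ := logPower_pos (α := α) hx.1 hx.2
  have hx0 := hx.1
  rw [abs_of_nonneg (sub_nonneg.2 (periodicProfile_zero_le hα w))]
  refine (periodicProfile_sub_le hα hα1 w).trans (mul_le_mul_of_nonneg_left ?_ zero_le_two)
  refine (logPower_le_growth hα hα1 hs hx.1 hx.2 (abs_sin_le_one w)).trans ?_
  gcongr _ * (1 + ?_ / _) ^ _
  exact abs_sin_le_abs

theorem dyadicProfile_periodicProfile (hα : 0 < α) (hα1 : α ≤ 1) (hs : 0 < s) :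
    DyadicProfile s (π / 4) (36 * (1 + 1 / s)) (α / 32) (logPower α) (periodicProfile α) := by
  have hpi := pi_pos
  have hIoc {x : ℝ} (hx : x ∈ Ioc 0 (π / 4)) : x ∈ Ioc 0 1 := ⟨hx.1, by linarith [hx.2, pi_le_four]⟩
  refine ⟨by positivity, by positivity, fun x hx => logPower_pos hx.1 (hIoc hx).2,
    (monotoneOn_periodicProfile hα hα1).mono (Icc_subset_Icc_right (by linarith)),
    fun x hx w => ?_, fun x hx w v hw hwv hv hva => ?_,
    fun x y hx hxy hy2 hya => le_periodicProfile_sub hα hα1 hx hxy hya hy2⟩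
  all_goals
    have hx0 := hx.1
    have hφ := logPower_pos (α := α) hx.1 (hIoc hx).2
  · refine (abs_periodicProfile_sub_zero_le hα hα1 hs (hIoc hx) w).trans ?_
    rw [mul_assoc 36, mul_assoc 36]
    gcongr
    norm_num
  · have hsin := logPower_sin_sub_le hα hα1 (hIoc hx) hw hwv hv (by linarith)
    have hcos := logPower_cos_sub_le hα hα1 (hIoc hx) (by linarith) hwv hv (by linarith)
    have := sub_nonneg.2 hwv
    calc periodicProfile α v - periodicProfile α w ≤ 36 * 1 * logPower α x / x * (v - w) := by
          rw [periodicProfile, periodicProfile, mul_one, mul_div_assoc]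
          linarith
      _ ≤ _ := by
          gcongr
          exact le_add_of_nonneg_right (by positivity)

end PeriodicProfile

/-! ### Regularity of the periodic profile -/

section Regularity

variable {α t ε ρ : ℝ}

/-- The derivative of `logPower 1` on `[-1, 1]`; the vanishing sign at `0` takes care of the junk
value `log 0 = 0`. -/
noncomputable def logPowerOneDeriv (t : ℝ) : ℝ :=
  SignType.sign t * (1 / (1 - log t) + 1 / (1 - log t) ^ 2)

theorem logPowerOneDeriv_zero : logPowerOneDeriv 0 = 0 := by
  rw [logPowerOneDeriv, _root_.sign_zero, SignType.coe_zero, zero_mul]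

theorem tendsto_one_div_one_sub_log_zero :
    Tendsto (fun t : ℝ => 1 / (1 - log t)) (𝓝[≠] 0) (𝓝 0) := by
  simp only [one_div, sub_eq_add_neg]
  exact (tendsto_atTop_add_const_left _ (1 : ℝ)
    (tendsto_neg_atBot_atTop.comp tendsto_log_nhdsNE_zero)).inv_tendsto_atTop

theorem hasDerivAt_logPower_one (ht : |t| ≤ 1) :
    HasDerivAt (logPower 1) (logPowerOneDeriv t) t := by
  have hlogPower : logPower 1 = fun t => |t| / (1 - log t) := by
    funext t
    rw [logPower, rpow_one]
  rcases eq_or_ne t 0 with rfl | ht0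
  · rw [hasDerivAt_iff_tendsto_slope_zero, logPowerOneDeriv_zero]
    refine squeeze_zero_norm' ?_ (by simpa using tendsto_one_div_one_sub_log_zero.abs)
    filter_upwards [self_mem_nhdsWithin] with t ht
    have ht0 : |t| ≠ 0 := abs_ne_zero.2 ht
    rw [zero_add, logPower_zero one_pos, sub_zero, hlogPower, smul_eq_mul, norm_eq_abs, abs_mul,
      abs_inv, abs_div, abs_abs, inv_mul_eq_div, div_div_cancel_left' ht0]
  · have hlog : 1 - log t ≠ 0 := (one_pos.trans_le (one_le_one_sub_log ht)).ne'
    rw [hlogPower]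
    refine ((hasDerivAt_abs ht0).div ((hasDerivAt_log ht0).const_sub 1) hlog).congr_deriv ?_
    rw [logPowerOneDeriv]
    rcases ht0.lt_or_gt with htneg | htpos
    · simp only [_root_.sign_neg htneg, abs_of_neg htneg, SignType.coe_neg_one]
      field_simp
      ring
    · simp only [_root_.sign_pos htpos, abs_of_pos htpos, SignType.coe_one]
      field_simp
      ring

theorem continuousAt_logPowerOneDeriv (ht : |t| ≤ 1) : ContinuousAt logPowerOneDeriv t := by
  rcases eq_or_ne t 0 with rfl | ht0
  · rw [← continuousWithinAt_compl_self, ContinuousWithinAt, logPowerOneDeriv_zero]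
    have hlim := (tendsto_one_div_one_sub_log_zero.add (tendsto_one_div_one_sub_log_zero.pow 2)).abs
    rw [zero_pow two_ne_zero, add_zero, abs_zero] at hlim
    refine squeeze_zero_norm (fun t => ?_) hlim
    rw [logPowerOneDeriv, norm_mul, norm_eq_abs, norm_eq_abs, div_pow, one_pow]
    refine mul_le_of_le_one_left (abs_nonneg _) ?_
    rcases lt_trichotomy t 0 with h | h | h <;> simp [h]
  · have hlog : 1 - log t ≠ 0 := (one_pos.trans_le (one_le_one_sub_log ht)).ne'
    have hsign : ContinuousAt (fun t : ℝ => (SignType.sign t : ℝ)) t :=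
      (continuous_of_discreteTopology (f := fun σ : SignType => (σ : ℝ))).continuousAt.comp
        (continuousAt_sign_of_ne_zero ht0)
    have hlogc : ContinuousAt (fun t => 1 - log t) t :=
      continuousAt_const.sub (continuousAt_log ht0)
    exact hsign.mul ((continuousAt_const.div hlogc hlog).add
      (continuousAt_const.div (hlogc.pow 2) (pow_ne_zero 2 hlog)))

theorem hasDerivAt_periodicProfile_one (x : ℝ) :
    HasDerivAt (periodicProfile 1)
      (logPowerOneDeriv (sin x) * cos x - logPowerOneDeriv (cos x) * -sin x) x :=
  ((hasDerivAt_logPower_one (abs_sin_le_one x)).comp x (hasDerivAt_sin x)).sub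
    ((hasDerivAt_logPower_one (abs_cos_le_one x)).comp x (hasDerivAt_cos x))

theorem contDiff_periodicProfile_one : ContDiff ℝ 1 (periodicProfile 1) := by
  refine contDiff_one_iff_deriv.2
    ⟨fun x => (hasDerivAt_periodicProfile_one x).differentiableAt, ?_⟩
  rw [funext fun x => (hasDerivAt_periodicProfile_one x).deriv]
  have hsin : Continuous fun x => logPowerOneDeriv (sin x) :=
    continuous_iff_continuousAt.2 fun x =>
      (continuousAt_logPowerOneDeriv (abs_sin_le_one x)).comp continuous_sin.continuousAt
  have hcos : Continuous fun x => logPowerOneDeriv (cos x) :=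
    continuous_iff_continuousAt.2 fun x =>
      (continuousAt_logPowerOneDeriv (abs_cos_le_one x)).comp continuous_cos.continuousAt
  exact (hsin.mul continuous_cos).sub (hcos.mul continuous_sin.neg)

theorem holderClass_periodicProfile (hα : 0 < α) (hα1 : α ≤ 1) :
    HolderClass α univ (periodicProfile α) := by
  rcases hα1.lt_or_eq with hα1' | rfl
  · exact (isBoundedHolder_periodicProfile hα hα1).holderClass hα hα1'
  · exact holderClass_one_of_periodic contDiff_periodicProfile_one (periodic_periodicProfile 1)
      pi_ne_zero

theorem logPower_isBigO_periodicProfile_sub (hα : 0 < α) (hα1 : α ≤ 1) :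
    logPower α =O[𝓝[>] 0] fun x => periodicProfile α x - periodicProfile α 0 := by
  refine Asymptotics.IsBigO.of_bound 4 ?_
  filter_upwards [Ioc_mem_nhdsGT one_pos] with x hx
  have hsin : x / 2 ≤ sin x := half_le_sin hx.1.le (by linarith [hx.2, pi_gt_three])
  rw [norm_of_nonneg (logPower_pos hx.1 hx.2).le,
    norm_of_nonneg (sub_nonneg.2 (periodicProfile_zero_le hα x))]
  calc logPower α x ≤ 2 ^ 2 * logPower α (sin x) :=
        logPower_le_sq_mul_of_le_mul hα hα1 ⟨by linarith [hx.1], sin_le_one x⟩ ⟨hx.1.le, hx.2⟩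
          one_le_two (by linarith)
    _ ≤ 4 * (periodicProfile α x - periodicProfile α 0) := by
        linarith [logPower_sin_le_periodicProfile_sub hα x]

theorem not_holderClass_periodicProfile (hα : 0 < α) (hα1 : α ≤ 1) (hε : 0 < ε) (hρ : 0 < ρ) :
    ¬ HolderClass (α + ε) (Icc (-ρ) ρ) (periodicProfile α) := by
  intro h
  have hgrowth := (h.isBigO_sub_of_isLocalMin ⟨neg_lt_zero.2 hρ, hρ⟩
    (.of_forall (periodicProfile_zero_le hα))).mono (nhdsWithin_le_nhds (s := Ioi 0))
  have hpow : (fun x : ℝ => |x - 0| ^ min (α + ε) 2) =ᶠ[𝓝[>] 0] fun x => x ^ min (α + ε) 2 := by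
    filter_upwards [self_mem_nhdsWithin] with x hx
    rw [sub_zero, abs_of_pos hx]
  have hself : logPower α =o[𝓝[>] 0] logPower α :=
    ((logPower_isBigO_periodicProfile_sub hα hα1).trans (hgrowth.trans_eventuallyEq hpow))
      |>.trans_isLittleO (rpow_isLittleO_logPower (lt_min (by linarith) (by linarith)))
  refine Asymptotics.isLittleO_irrefl (Eventually.frequently ?_) hself
  filter_upwards [Ioc_mem_nhdsGT one_pos] with x hx using (logPower_pos hx.1 hx.2).ne'

end Regularity

section Nonlinearity

variable {α s β : ℝ}

theorem exists_periodicProfile_fracIntegral_eq (s α x : ℝ) :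
    ∃ y ∈ Icc 0 (π / 2), periodicProfile α y = periodicProfile α x ∧
      fracIntegral s (periodicProfile α) y = fracIntegral s (periodicProfile α) x := by
  have heven (z : ℝ) : fracIntegral s (periodicProfile α) (-z) =
      fracIntegral s (periodicProfile α) z := by
    simpa [periodicProfile_neg] using
      (fracIntegral_comp_affine s (periodicProfile α) (neg_ne_zero.2 one_ne_zero) 0 z).symm
  have hperiodic : Function.Periodic (fracIntegral s (periodicProfile α)) π := fun z => by
    simpa [add_comm π, periodic_periodicProfile α _] using
      (fracIntegral_comp_affine s (periodicProfile α) one_ne_zero π z).symm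
  set r := x - round (x / π) * π with hr
  have hu : periodicProfile α r = periodicProfile α x :=
    (periodic_periodicProfile α).sub_int_mul_eq _
  have hH : fracIntegral s (periodicProfile α) r = fracIntegral s (periodicProfile α) x :=
    hperiodic.sub_int_mul_eq _
  have hrle : |r| ≤ π / 2 := by
    have h : r = (x / π - round (x / π)) * π := by
      rw [hr, sub_mul, div_mul_cancel₀ _ pi_ne_zero]
    rw [h, abs_mul, abs_of_pos pi_pos]
    nlinarith [abs_sub_round (x / π), pi_pos]
  refine ⟨|r|, ⟨abs_nonneg r, hrle⟩, ?_⟩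
  rcases abs_choice r with h | h <;> rw [h]
  · exact ⟨hu, hH⟩
  · exact ⟨(periodicProfile_neg α r).trans hu, (heven r).trans hH⟩

theorem fracIntegral_periodicProfile_pi_div_two_sub (s α x : ℝ) :
    fracIntegral s (periodicProfile α) (π / 2 - x) = -fracIntegral s (periodicProfile α) x := by
  have h := fracIntegral_comp_affine s (periodicProfile α) (neg_ne_zero.2 one_ne_zero) (π / 2) x
  simp only [neg_one_mul, ← sub_eq_add_neg, periodicProfile_pi_div_two_sub, fracIntegral_neg,
    abs_neg, abs_one, one_rpow, one_mul] at h
  exact h.symm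

theorem holderControlledOn_fracIntegral_periodicProfile (hs : 0 < s) (hβ : 0 < β) (hα : 0 < α)
    (hα1 : α ≤ 1) (hscale : 2 * s = α * (1 - β)) :
    HolderControlledOn β (periodicProfile α) (fracIntegral s (periodicProfile α)) univ := by
  have hβ1 : 0 < 1 - β := pos_of_mul_pos_right (hscale ▸ by positivity) hα.le
  have hsβ : 2 * s ≤ 1 - β := hscale.trans_le (mul_le_of_le_one_left hβ1.le hα1)
  have hsα : 2 * s < α := hscale.trans_lt (mul_lt_of_lt_one_right hα (by linarith))
  have hscale' (x : ℝ) (hx : x ∈ Ioc 0 (π / 4)) : logPower α x ^ (1 - β) ≤ x ^ (2 * s) := by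
    have hx1 : x ≤ 1 := by linarith [hx.2, pi_le_four]
    rw [hscale, rpow_mul hx.1.le]
    refine rpow_le_rpow (logPower_pos hx.1 hx1).le ?_ hβ1.le
    simpa only [abs_of_pos hx.1] using logPower_le_rpow (abs_le.2 ⟨by linarith [hx.1], hx1⟩)
  have hleft : HolderControlledOn β (periodicProfile α) (fracIntegral s (periodicProfile α))
      (Icc 0 (π / 4)) :=
    (dyadicProfile_periodicProfile hα hα1 hs).holderControlledOn_fracIntegral hs (by linarith) hsα
      hβ (by linarith) (isBoundedHolder_periodicProfile hα hα1) hscale'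
  have hright := hleft.reflect (periodicProfile_pi_div_two_sub α)
    (fracIntegral_periodicProfile_pi_div_two_sub s α)
  rw [preimage_const_sub_Icc, sub_zero, show π / 2 - π / 4 = π / 4 by ring] at hright
  exact (hleft.Icc_union hright hβ.le (monotoneOn_periodicProfile hα hα1)).of_forall_exists
    (exists_periodicProfile_fracIntegral_eq s α)

end Nonlinearity

theorem proposition3p1 (s β : ℝ) (hβ0 : 0 < β) (hβ1 : β < 1)
    (hs0 : 0 < 2 * s) (hs1 : 2 * s ≤ 1 - β) :
    ∃ u f : ℝ → ℝ,
      HolderClass (2 * s / (1 - β)) univ u ∧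
      HolderClass β univ f ∧
      (∃ T : ℝ, 0 < T ∧ Function.Periodic u T) ∧
      (∀ x : ℝ, HasFracLaplacianAt s u x (f (u x))) ∧
      ∀ ε ρ : ℝ, 0 < ε → 0 < ρ →
        ¬ HolderClass (2 * s / (1 - β) + ε) (Icc (-ρ) ρ) u := by
  have hs : 0 < s := by linarith
  have hβ' : 0 < 1 - β := by linarith
  set α := 2 * s / (1 - β)
  have hα : 0 < α := div_pos hs0 hβ'
  have hα1 : α ≤ 1 := (div_le_one hβ').2 hs1
  have hscale : 2 * s = α * (1 - β) := (div_mul_cancel₀ _ hβ'.ne').symm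
  have hsα : 2 * s < α := hscale.trans_lt (mul_lt_of_lt_one_right hα (by linarith))
  have hu := isBoundedHolder_periodicProfile hα hα1
  obtain ⟨f, hf, hfu⟩ :=
    ((holderControlledOn_fracIntegral_periodicProfile hs hβ0 hα hα1 hscale).const_mul
      (fracLaplacianConst s)).exists_holderClass_comp_eq hβ0 hβ1 (range_periodicProfile hα hα1)
  refine ⟨periodicProfile α, f, holderClass_periodicProfile hα hα1, hf,
    ⟨π, pi_pos, periodic_periodicProfile α⟩, fun x => ?_,
    fun ε ρ hε hρ => not_holderClass_periodicProfile hα hα1 hε hρ⟩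
  rw [hfu]
  exact hu.hasFracLaplacianAt hs hsα x
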